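/- All graphs are finite, undirected and simple. Let $G$ be a graph and let $M$ be a maximum matching of $G$. A walk is *$M$-alternating* if, of every two consecutive edges, exactly one lies in $M$; it is *mm-alternating* if moreover its first and last edges lie in $M$. A path is a walk without repeated vertices. - An *$M$-blossom* is an odd cycle of length $2k+1$ containing exactly $k$ edges of $M$; its *base* is its unique vertex that $M$ does not match to another vertex of the cycle. - An *$M$-flower* consists of an $M$-blossom and an $M$-alternating path of even length (possibly $0$) from its base to a vertex unmatched by $M$, such that the base is the only vertex common to the blossom and the path. - An *$M$-Jflower* consists of an $M$-blossom and an $M$-alternating walk of even length (possibly $0$) from its base to a vertex unmatched by $M$. - An *$M$-posy* consists of two distinct (not necessarily disjoint) $M$-blossoms and an mm-alternating path of odd length joining their bases. - An *$M$-Tposy* is an $M$-posy in which no internal vertex of the path lies on either blossom. - An *$M$-Jposy* consists of two (not necessarily distinct) $M$-blossoms and an mm-alternating walk of odd length joining their bases. A vertex *lies in* such a configuration if it is a vertex of one of its blossoms or of its path or walk. Let $V_T(G)$ be the set of vertices of $G$ that lie in an $M$-flower or an $M$-Tposy for some maximum matching $M$ of $G$; let $V_{ESG}(G)$ be the set of vertices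 that lie in an $M$-flower or an $M$-posy for some maximum matching $M$; and let $V_J(G)$ be the set of vertices that lie in an $M$-Jflower or an $M$-Jposy for some maximum matching $M$. **Theorem.** For every graph $G$, $$V_T(G) = V_{ESG}(G) = V_J(G).$$ -/

import Mathlib

namespace SterboulDeming

variable {V : Type*} {G : SimpleGraph V}

/-- `M` is a maximum matching of `G` (intended for finite graphs): a matching with the largest
possible number of edges. -/
def IsMaximumMatching (M : G.Subgraph) : Prop :=
  M.IsMatching ∧ ∀ M' : G.Subgraph, M'.IsMatching → M'.edgeSet.ncard ≤ M.edgeSet.ncard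

/-- The walk `p` is `M`-alternating: of any two consecutive edges, exactly one belongs to `M`. -/
def IsAlternatingWalk (M : G.Subgraph) {u v : V} (p : G.Walk u v) : Prop :=
  p.edges.IsChain fun e f => (e ∈ M.edgeSet ↔ f ∉ M.edgeSet)

/-- The walk `p` is `mm`-alternating: it is alternating and starts and ends with edges of `M`. -/
def IsMMAlternatingWalk (M : G.Subgraph) {u v : V} (p : G.Walk u v) : Prop :=
  IsAlternatingWalk M p ∧
    (∃ e ∈ p.edges.head?, e ∈ M.edgeSet) ∧ (∃ e ∈ p.edges.getLast?, e ∈ M.edgeSet)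

/-- The closed walk `B` at `b` traverses an `M`-blossom with base `b`: it is a cycle of length
`2k + 1` containing exactly `k` edges of `M`, and `b` is the vertex of the cycle that `M` does not
match to another vertex of the cycle. -/
def IsBlossom (M : G.Subgraph) {b : V} (B : G.Walk b b) : Prop :=
  B.IsCycle ∧
    (∃ k : ℕ, B.length = 2 * k + 1 ∧ (B.edgeSet ∩ M.edgeSet).ncard = k) ∧
    ∀ w ∈ B.support, ¬ M.Adj b w

/-- An `M`-flower: an `M`-blossom `B` with base `b`, together with a stem `S`, an alternating path
of even length (possibly zero) from `b` to a vertex `u` unmatched by `M`, sharing only `b`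
with `B`. -/
def IsFlower (M : G.Subgraph) {b u : V} (B : G.Walk b b) (S : G.Walk b u) : Prop :=
  IsBlossom M B ∧ S.IsPath ∧ IsAlternatingWalk M S ∧ Even S.length ∧ u ∉ M.support ∧
    ∀ w ∈ B.support, w ∈ S.support → w = b

/-- An `M`-Jflower: the stem is replaced by an alternating walk of even length from the base `b`
to an unmatched vertex `u`; it may repeat vertices and edges and may meet the blossom. -/
def IsJflower (M : G.Subgraph) {b u : V} (B : G.Walk b b) (W : G.Walk b u) : Prop :=
  IsBlossom M B ∧ IsAlternatingWalk M W ∧ Even W.length ∧ u ∉ M.support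

/-- An `M`-posy: two distinct (not necessarily disjoint) `M`-blossoms whose bases are joined by
an odd-length `mm`-alternating path. -/
def IsPosy (M : G.Subgraph) {b₁ b₂ : V}
    (B₁ : G.Walk b₁ b₁) (P : G.Walk b₁ b₂) (B₂ : G.Walk b₂ b₂) : Prop :=
  IsBlossom M B₁ ∧ IsBlossom M B₂ ∧ B₁.toSubgraph ≠ B₂.toSubgraph ∧
    P.IsPath ∧ IsMMAlternatingWalk M P ∧ Odd P.length

/-- An `M`-Tposy: an `M`-posy in which no internal vertex of the path lies on a blossom. -/
def IsTposy (M : G.Subgraph) {b₁ b₂ : V}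
    (B₁ : G.Walk b₁ b₁) (P : G.Walk b₁ b₂) (B₂ : G.Walk b₂ b₂) : Prop :=
  IsPosy M B₁ P B₂ ∧
    ∀ w ∈ P.support, w ≠ b₁ → w ≠ b₂ → w ∉ B₁.support ∧ w ∉ B₂.support

/-- An `M`-Jposy: two (not necessarily distinct) `M`-blossoms whose bases are joined by an
odd-length `mm`-alternating walk. -/
def IsJposy (M : G.Subgraph) {b₁ b₂ : V}
    (B₁ : G.Walk b₁ b₁) (W : G.Walk b₁ b₂) (B₂ : G.Walk b₂ b₂) : Prop :=
  IsBlossom M B₁ ∧ IsBlossom M B₂ ∧ IsMMAlternatingWalk M W ∧ Odd W.length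

/-- `v` lies in some `M`-flower. -/
def InFlower (M : G.Subgraph) (v : V) : Prop :=
  ∃ (b u : V) (B : G.Walk b b) (S : G.Walk b u),
    IsFlower M B S ∧ (v ∈ B.support ∨ v ∈ S.support)

/-- `v` lies in some `M`-Jflower. -/
def InJflower (M : G.Subgraph) (v : V) : Prop :=
  ∃ (b u : V) (B : G.Walk b b) (W : G.Walk b u),
    IsJflower M B W ∧ (v ∈ B.support ∨ v ∈ W.support)

/-- `v` lies in some `M`-posy. -/
def InPosy (M : G.Subgraph) (v : V) : Prop :=
  ∃ (b₁ b₂ : V) (B₁ : G.Walk b₁ b₁) (P : G.Walk b₁ b₂) (B₂ : G.Walk b₂ b₂),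
    IsPosy M B₁ P B₂ ∧ (v ∈ B₁.support ∨ v ∈ P.support ∨ v ∈ B₂.support)

/-- `v` lies in some `M`-Tposy. -/
def InTposy (M : G.Subgraph) (v : V) : Prop :=
  ∃ (b₁ b₂ : V) (B₁ : G.Walk b₁ b₁) (P : G.Walk b₁ b₂) (B₂ : G.Walk b₂ b₂),
    IsTposy M B₁ P B₂ ∧ (v ∈ B₁.support ∨ v ∈ P.support ∨ v ∈ B₂.support)

/-- `v` lies in some `M`-Jposy. -/
def InJposy (M : G.Subgraph) (v : V) : Prop :=
  ∃ (b₁ b₂ : V) (B₁ : G.Walk b₁ b₁) (W : G.Walk b₁ b₂) (B₂ : G.Walk b₂ b₂),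
    IsJposy M B₁ W B₂ ∧ (v ∈ B₁.support ∨ v ∈ W.support ∨ v ∈ B₂.support)

/-- The vertices lying in some flower or some Tposy, relative to some maximum matching. -/
def VT (G : SimpleGraph V) : Set V :=
  {v | ∃ M : G.Subgraph, IsMaximumMatching M ∧ (InFlower M v ∨ InTposy M v)}

/-- The vertices lying in some flower or some posy, relative to some maximum matching. -/
def VESG (G : SimpleGraph V) : Set V :=
  {v | ∃ M : G.Subgraph, IsMaximumMatching M ∧ (InFlower M v ∨ InPosy M v)}

/-- The vertices lying in some Jflower or some Jposy, relative to some maximum matching. -/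
def VJ (G : SimpleGraph V) : Set V :=
  {v | ∃ M : G.Subgraph, IsMaximumMatching M ∧ (InJflower M v ∨ InJposy M v)}

end SterboulDeming

/-! A matching is an involution `φ`. Let a vertex `x` stand for its matching edge traversed from `φ
x` to `x`; an `Arc` is then a non-matching edge followed by a matching one. Directed walks are
alternating walks, and reversing a walk means applying `φ`: the digraph is skew-symmetric.

A flower is a Jflower, a Tposy is a posy and a posy is a Jposy, so the content is the passage from
`VJ` to `VT`. A walk can turn round in a blossom or at an unmatched vertex. Hence a vertex `v` of a
Jflower or Jposy lies on a closed directed walk through both `v` and `φ v` (`Bireachable`). Such a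
walk has to be turned into a flower or a Tposy, possibly for another maximum matching.

If `v` is unmatched, the walk from `v`, cut when it first meets its own reverse, gives a flower.
Otherwise take a maximal set `P` containing `v` that is strongly connected and disjoint from its
mirror image `φ P`. The walk from `v` to `φ v` must leave `P` for good. Stopped when it reaches an
unmatched vertex, one of its own matching edges in the opposite direction, or `φ P`, it yields a
`Side` `c`; the walk from `φ v` to `v` likewise yields a side `d` leaving `φ P`. By maximality no
outside path leaves `P` and returns to it, so `c` and `d` are disjoint or merge in the same
direction (`disjoint_or_merge`).

The two sides must be linked inside `P` by a path through `v`, whereas strong connectivity only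
gives a walk. A directed cycle in `P` is an even alternating cycle. Switching the matching along it
reverses the cycle, keeps `P` elementary, and changes nothing outside `P` and `φ P`; repeated
switches turn the walk into a path (`exists_path_through`).

If the sides are disjoint, each end of this path runs on to a blossom or an unmatched vertex
(`exists_terminal`), which gives a flower or a Tposy. If they merge at `z`, the path and the two
sides form a blossom with base `φ z`, and the common continuation becomes the stem or the connecting
path. -/

namespace SterboulDeming

open Relation

variable {V : Type*} {G : SimpleGraph V}

/-! ### Matchings as involutions and the skew-symmetric digraph of arcs -/

/-- A matching of `G` encoded as an involution: unmatched vertices are the fixed points. -/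
structure IsMate (G : SimpleGraph V) (φ : Equiv.Perm V) : Prop where
  invol : ∀ x, φ (φ x) = x
  adj : ∀ x, φ x ≠ x → G.Adj x (φ x)

/-- From `x`, follow an edge outside the matching to `φ y`, then the matching edge to `y`. -/
def Arc (G : SimpleGraph V) (φ : Equiv.Perm V) (x y : V) : Prop :=
  G.Adj x (φ y) ∧ x ≠ y

/-- The matching edge at `x` (a loop if `x` is unmatched). -/
def edge (φ : Equiv.Perm V) (x : V) : Sym2 V := s(x, φ x)

/-- A list of vertices, each standing for its matching edge traversed towards it, read backwards. -/
def mirror (φ : Equiv.Perm V) (l : List V) : List V := (l.map φ).reverse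

@[simp] lemma mirror_nil (φ : Equiv.Perm V) : mirror φ [] = [] := rfl

@[simp] lemma mirror_append (φ : Equiv.Perm V) (l l' : List V) :
    mirror φ (l ++ l') = mirror φ l' ++ mirror φ l := by simp [mirror]

@[simp] lemma mirror_cons (φ : Equiv.Perm V) (x : V) (l : List V) :
    mirror φ (x :: l) = mirror φ l ++ [φ x] := by simp [mirror]

@[simp] lemma mirror_eq_nil {φ : Equiv.Perm V} {l : List V} : mirror φ l = [] ↔ l = [] := by
  simp [mirror]

namespace IsMate

variable {φ : Equiv.Perm V} (hφ : IsMate G φ)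
include hφ

lemma mem_mirror {l : List V} {x : V} : x ∈ mirror φ l ↔ φ x ∈ l := by
  simp only [mirror, List.mem_reverse, List.mem_map]
  constructor
  · rintro ⟨a, ha, rfl⟩
    rwa [hφ.invol]
  · exact fun h => ⟨_, h, hφ.invol x⟩

lemma mirror_mirror (l : List V) : mirror φ (mirror φ l) = l := by
  simp [mirror, Function.comp_def, hφ.invol]

lemma apply_eq_iff {x y : V} : φ x = y ↔ x = φ y := by
  constructor
  · rintro rfl; rw [hφ.invol]
  · rintro rfl; rw [hφ.invol]

lemma edge_eq_iff {x y : V} : edge φ x = edge φ y ↔ x = y ∨ x = φ y := by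
  simp only [edge, Sym2.eq_iff]
  constructor
  · rintro (⟨h, -⟩ | ⟨h, -⟩) <;> simp [h]
  · rintro (rfl | rfl) <;> simp [hφ.invol]

lemma edge_apply (x : V) : edge φ (φ x) = edge φ x := by simp [hφ.edge_eq_iff]

lemma edge_mem_mirror {l : List V} {e : Sym2 V} :
    e ∈ (mirror φ l).map (edge φ) ↔ e ∈ l.map (edge φ) := by
  simp [mirror, Function.comp_def, hφ.edge_apply]

lemma nodup_edge_mirror {l : List V} :
    ((mirror φ l).map (edge φ)).Nodup ↔ (l.map (edge φ)).Nodup := by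
  simp [mirror, Function.comp_def, hφ.edge_apply]

/-- The non-matching edge between `x` and `φ y` is read backwards: `φ` is an anti-automorphism of
the digraph. -/
lemma arc_mirror {x y : V} (h : Arc G φ x y) : Arc G φ (φ y) (φ x) := by
  refine ⟨?_, fun h' => h.2 (φ.injective h').symm⟩
  rw [hφ.invol]; exact h.1.symm

lemma isChain_mirror {l : List V} (h : l.IsChain (Arc G φ)) :
    (mirror φ l).IsChain (Arc G φ) := by
  rw [mirror, List.isChain_reverse, List.isChain_map]
  exact h.imp fun _ _ h => hφ.arc_mirror h

lemma reflTransGen_mirror {x y : V} (h : Relation.ReflTransGen (Arc G φ) x y) :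
    Relation.ReflTransGen (Arc G φ) (φ y) (φ x) := by
  induction h with
  | refl => exact .refl
  | tail _ h ih => exact .head (hφ.arc_mirror h) ih

/-- The subgraph of matching edges. -/
def matching : G.Subgraph where
  verts := {x | φ x ≠ x}
  Adj x y := φ x = y ∧ x ≠ y
  adj_sub := by
    rintro x y ⟨rfl, h⟩
    exact hφ.adj x h.symm
  edge_vert := by
    rintro x y ⟨rfl, h⟩
    exact h.symm
  symm := ⟨by
    rintro x y ⟨rfl, h⟩
    exact ⟨hφ.invol x, h.symm⟩⟩

lemma matching_adj {x y : V} : hφ.matching.Adj x y ↔ φ x = y ∧ x ≠ y := Iff.rfl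

lemma isMatching_matching : hφ.matching.IsMatching := by
  intro x hx
  exact ⟨φ x, ⟨rfl, Ne.symm hx⟩, fun y hy => hy.1.symm⟩

lemma notMem_support_matching {x : V} : x ∉ hφ.matching.support ↔ φ x = x := by
  rw [hφ.isMatching_matching.support_eq_verts]
  simp [matching]

lemma mem_edgeSet_matching {x y : V} : s(x, y) ∈ hφ.matching.edgeSet ↔ φ x = y ∧ x ≠ y := by
  rw [SimpleGraph.Subgraph.mem_edgeSet]; rfl

/-- Handshake lemma. It lets maximality be measured by matched vertices, a number that conjugating
`φ` visibly preserves. -/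
lemma two_mul_ncard_edgeSet [Finite V] :
    2 * hφ.matching.edgeSet.ncard = {x | φ x ≠ x}.ncard := by
  classical
  have := Fintype.ofFinite V
  have h := hφ.matching.spanningCoe.sum_degrees_eq_twice_card_edges
  have h1 : hφ.matching.edgeSet.ncard = hφ.matching.spanningCoe.edgeFinset.card := by
    rw [← Set.ncard_coe_finset]
    simp
  have h2 : ∀ x, hφ.matching.spanningCoe.degree x = if φ x ≠ x then 1 else 0 := by
    intro x
    rw [← SimpleGraph.card_neighborFinset_eq_degree]
    split_ifs with hx
    · rw [Finset.card_eq_one]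
      refine ⟨φ x, ?_⟩
      ext y
      simp only [SimpleGraph.mem_neighborFinset, SimpleGraph.Subgraph.spanningCoe_adj,
        hφ.matching_adj, Finset.mem_singleton]
      constructor
      · exact fun h => h.1.symm
      · rintro rfl; exact ⟨rfl, hx.symm⟩
    · rw [Finset.card_eq_zero]
      ext y
      simp only [SimpleGraph.mem_neighborFinset, SimpleGraph.Subgraph.spanningCoe_adj,
        hφ.matching_adj]
      push Not at hx
      simp [hx]
  rw [h1, ← h]
  simp only [h2, Finset.sum_boole]
  rw [← Set.ncard_coe_finset]
  simp

end IsMate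

/-- A matching with the fewest unmatched vertices. -/
def IsMaxMate (G : SimpleGraph V) (φ : Equiv.Perm V) : Prop :=
  IsMate G φ ∧ ∀ ψ, IsMate G ψ → {x | ψ x ≠ x}.ncard ≤ {x | φ x ≠ x}.ncard

lemma exists_isMate_of_isMatching {M : G.Subgraph} (hM : M.IsMatching) :
    ∃ (φ : Equiv.Perm V) (hφ : IsMate G φ), hφ.matching = M := by
  classical
  let f : V → V := fun x => if h : x ∈ M.verts then (hM h).choose else x
  have hf : ∀ x, x ∈ M.verts → M.Adj x (f x) := by
    intro x hx
    simp only [f, hx, dif_pos]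
    exact (hM hx).choose_spec.1
  have hf' : ∀ x, x ∉ M.verts → f x = x := fun x hx => by simp [f, hx]
  have hinv : Function.Involutive f := by
    intro x
    by_cases hx : x ∈ M.verts
    · have h1 := hf x hx
      exact hM.eq_of_adj_left (hf _ (M.edge_vert h1.symm)) h1.symm
    · rw [hf' x hx, hf' x hx]
  have hmate : IsMate G (hinv.toPerm f) := by
    refine ⟨hinv, fun x hx => ?_⟩
    by_cases h : x ∈ M.verts
    · exact (hf x h).adj_sub
    · exact absurd (hf' x h) hx
  refine ⟨_, hmate, ?_⟩
  ext x y
  · change f x ≠ x ↔ _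
    by_cases h : x ∈ M.verts
    · simpa [h] using (M.adj_sub (hf x h)).ne'
    · simp [h, hf' x h]
  · change f x = y ∧ x ≠ y ↔ _
    constructor
    · rintro ⟨rfl, h⟩
      by_cases h' : x ∈ M.verts
      · exact hf x h'
      · exact absurd (hf' x h').symm h
    · intro h
      exact ⟨hM.eq_of_adj_left (hf x (M.edge_vert h)) h, h.ne⟩

lemma IsMaxMate.isMaximumMatching [Finite V] {φ : Equiv.Perm V} (h : IsMaxMate G φ) :
    IsMaximumMatching h.1.matching := by
  refine ⟨h.1.isMatching_matching, fun M' hM' => ?_⟩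
  obtain ⟨ψ, hψ, rfl⟩ := exists_isMate_of_isMatching hM'
  have := h.2 ψ hψ
  rw [← hψ.two_mul_ncard_edgeSet, ← h.1.two_mul_ncard_edgeSet] at this
  omega

lemma IsMaximumMatching.exists_isMaxMate [Finite V] {M : G.Subgraph} (hM : IsMaximumMatching M) :
    ∃ (φ : Equiv.Perm V) (h : IsMaxMate G φ), h.1.matching = M := by
  obtain ⟨φ, hφ, rfl⟩ := exists_isMate_of_isMatching hM.1
  refine ⟨φ, ⟨hφ, fun ψ hψ => ?_⟩, rfl⟩
  have := hM.2 _ hψ.isMatching_matching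
  rw [← hψ.two_mul_ncard_edgeSet, ← hφ.two_mul_ncard_edgeSet]
  omega

/-- Conjugating a matching by a permutation keeps the number of matched vertices. -/
lemma ncard_support_conj (φ σ : Equiv.Perm V) :
    {x | (σ⁻¹ * φ * σ) x ≠ x}.ncard = {x | φ x ≠ x}.ncard := by
  rw [← Set.ncard_image_of_injective {x | (σ⁻¹ * φ * σ) x ≠ x} σ.injective]
  congr 1
  ext y
  simp only [Set.mem_image, Set.mem_ofPred_eq, Equiv.Perm.mul_apply]
  constructor
  · rintro ⟨x, hx, rfl⟩ h
    apply hx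
    rw [h]; simp
  · intro h
    refine ⟨σ⁻¹ y, fun h' => h ?_, by simp⟩
    simpa using h'

lemma IsMaxMate.conj {φ σ : Equiv.Perm V} (h : IsMaxMate G φ) (h' : IsMate G (σ⁻¹ * φ * σ)) :
    IsMaxMate G (σ⁻¹ * φ * σ) :=
  ⟨h', fun ψ hψ => by rw [ncard_support_conj]; exact h.2 ψ hψ⟩

/-! ### From chains of arcs to blossoms, flowers and Tposies -/

namespace IsMate

variable {φ : Equiv.Perm V} (hφ : IsMate G φ)
include hφ

/-- The flattened list is the vertex sequence of the alternating walk encoded by `l`, so all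
questions of disjointness reduce to matching edges. -/
lemma mem_flatMap_iff {l : List V} {w : V} :
    w ∈ l.flatMap (fun y => [φ y, y]) ↔ edge φ w ∈ l.map (edge φ) := by
  simp only [List.mem_flatMap, List.mem_cons, List.not_mem_nil, or_false, List.mem_map,
    hφ.edge_eq_iff]
  refine exists_congr fun y => and_congr_right fun _ => ?_
  rw [or_comm, eq_comm (a := w) (b := y), ← hφ.apply_eq_iff (x := w), eq_comm (a := φ w)]

lemma nodup_flatMap {l : List V} (hl : ∀ y ∈ l, φ y ≠ y) (hnd : (l.map (edge φ)).Nodup) :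
    (l.flatMap (fun y => [φ y, y])).Nodup := by
  induction l with
  | nil => simp
  | cons a l ih =>
    have h1 := ih (fun y hy => hl y (by simp [hy])) (by simp at hnd; simpa using hnd.2)
    have h2 : edge φ a ∉ l.map (edge φ) := by
      rw [List.map_cons, List.nodup_cons] at hnd; exact hnd.1
    rw [List.flatMap_cons, List.cons_append, List.cons_append, List.nil_append, List.nodup_cons,
      List.nodup_cons, List.mem_cons, hφ.mem_flatMap_iff, hφ.mem_flatMap_iff, hφ.edge_apply]
    exact ⟨not_or.2 ⟨hl a (by simp), h2⟩, h2, h1⟩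

lemma exists_walk {l : List V} {x z : V} (hc : (x :: l).IsChain (Arc G φ))
    (hl : ∀ y ∈ l, φ y ≠ y) (hz : (x :: l).getLast? = some z) :
    ∃ p : G.Walk x z, p.support = x :: l.flatMap (fun y => [φ y, y]) ∧
      IsAlternatingWalk hφ.matching p ∧ p.length = 2 * l.length ∧
      (∀ e ∈ p.edges.head?, e ∉ hφ.matching.edgeSet) ∧
      (∀ e ∈ p.edges.getLast?, e ∈ hφ.matching.edgeSet) ∧
      ∀ [DecidablePred (· ∈ hφ.matching.edgeSet)],
        p.edges.countP (· ∈ hφ.matching.edgeSet) = l.length := by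
  induction l generalizing x with
  | nil =>
    obtain rfl : x = z := by simpa using hz
    exact ⟨.nil, by simp [IsAlternatingWalk]⟩
  | cons y l ih =>
    rw [List.isChain_cons_cons] at hc
    obtain ⟨p, h1, h2, h3, h4, h5, h6⟩ :=
      ih hc.2 (fun y hy => hl y (by simp [hy])) (by simpa using hz)
    have hy : G.Adj (φ y) y := (hφ.adj y (hl y (by simp))).symm
    have e1 : s(x, φ y) ∉ hφ.matching.edgeSet := by
      rw [hφ.mem_edgeSet_matching]
      rintro ⟨h, -⟩
      exact hc.1.2 (φ.injective h)
    have e2 : s(φ y, y) ∈ hφ.matching.edgeSet := by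
      rw [hφ.mem_edgeSet_matching]
      exact ⟨hφ.invol y, hl y (by simp)⟩
    refine ⟨.cons hc.1.1 (.cons hy p), ?_, ?_, ?_, ?_, ?_, ?_⟩
    · simp [h1]
    · unfold IsAlternatingWalk at h2 ⊢
      simp only [SimpleGraph.Walk.edges_cons, List.isChain_cons_cons]
      refine ⟨by simp [e1, e2], ?_⟩
      rw [List.isChain_cons]
      exact ⟨fun e he => by simp [e2, h4 e he], h2⟩
    · simp [h3]; ring
    · simp [e1]
    · simp only [SimpleGraph.Walk.edges_cons, List.getLast?_cons_cons]
      intro e he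
      cases hp : p.edges with
      | nil =>
        simp [hp] at he
        rwa [← he]
      | cons a t =>
        rw [hp, List.getLast?_cons_cons] at he
        exact h5 e (by rwa [hp])
    · intro _
      simp [e1, e2, h6]

/-- The token list `l` runs along a blossom with base `x`. -/
lemma exists_blossom {l : List V} {x : V} (hc : (x :: (l ++ [φ x])).IsChain (Arc G φ))
    (hl : ∀ y ∈ l, φ y ≠ y) (hnd : ((x :: l).map (edge φ)).Nodup) :
    ∃ B : G.Walk x x, IsBlossom hφ.matching B ∧
      ∀ w, w ∈ B.support ↔ w = x ∨ edge φ w ∈ l.map (edge φ) := by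
  classical
  have hc0 : (x :: l).IsChain (Arc G φ) := hc.prefix ⟨[φ x], by simp⟩
  obtain ⟨z, hz⟩ : ∃ z, (x :: l).getLast? = some z := ⟨_, List.getLast?_eq_some_getLast (by simp)⟩
  -- Of this last arc only the non-matching edge, from `z` to `x`, is kept: it closes the cycle.
  have hzx : Arc G φ z (φ x) := by
    rw [← List.cons_append, List.isChain_append] at hc
    exact hc.2.2 z hz (φ x) (by simp)
  obtain ⟨p, h1, h2, h3, h4, h5, h6⟩ := hφ.exists_walk hc0 hl hz
  have hxz : G.Adj x z := by
    have := hzx.1.symm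
    rwa [hφ.invol] at this
  have hx : edge φ x ∉ l.map (edge φ) := by
    rw [List.map_cons, List.nodup_cons] at hnd; exact hnd.1
  have hp : p.IsPath := by
    rw [SimpleGraph.Walk.isPath_def, h1, List.nodup_cons, hφ.mem_flatMap_iff]
    exact ⟨hx, hφ.nodup_flatMap hl (by rw [List.map_cons, List.nodup_cons] at hnd; exact hnd.2)⟩
  have hne : s(x, z) ∉ hφ.matching.edgeSet := by
    rw [hφ.mem_edgeSet_matching]
    rintro ⟨h, -⟩
    exact hzx.2 h.symm
  -- Only the first edge of the path `p` meets `x`, so a repetition would force `z = φ y` for the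
  -- first token `y`, whose matching edge would then occur twice in `l`.
  have hnp : s(x, z) ∉ p.edges := by
    match l, p, h1, hp, hz, hnd, hl with
    | [], _, _, _, hz, _, _ => exact absurd (by simpa using hz) hxz.ne
    | y :: l', p, h1, hp, hz, hnd, hl =>
      cases p with
      | nil => simp at hxz
      | cons h p' =>
        rename_i v
        rw [SimpleGraph.Walk.cons_isPath_iff] at hp
        have hv : v = φ y := by
          rw [SimpleGraph.Walk.support_cons] at h1
          have := List.cons.inj h1
          rw [← SimpleGraph.Walk.cons_tail_support] at this
          simpa using (List.cons.inj (this.2)).1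
        intro hmem
        rw [SimpleGraph.Walk.edges_cons, List.mem_cons] at hmem
        rcases hmem with hmem | hmem
        · have hzv : z = v := by
            rw [Sym2.eq_iff] at hmem
            rcases hmem with h | h
            · exact h.2
            · exact h.2.trans h.1
          have hzl : z ∈ y :: l' := List.mem_of_getLast? (by simpa using hz)
          rw [hv] at hzv
          rw [List.mem_cons] at hzl
          rcases hzl with h | h
          · exact hl y (by simp) (by rw [← hzv, h])
          · rw [List.map_cons, List.nodup_cons] at hnd
            rw [List.map_cons, List.nodup_cons] at hnd
            apply hnd.2.1
            rw [← hφ.edge_apply y, ← hzv]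
            exact List.mem_map_of_mem h
        · exact hp.2 (p'.fst_mem_support_of_mem_edges hmem)
  let B : G.Walk x x := .cons hxz p.reverse
  have hsupp : ∀ w, w ∈ B.support ↔ w = x ∨ edge φ w ∈ l.map (edge φ) := by
    intro w
    simp only [B, SimpleGraph.Walk.support_cons, SimpleGraph.Walk.support_reverse, List.mem_cons,
      List.mem_reverse, h1, hφ.mem_flatMap_iff]
    tauto
  refine ⟨B, ⟨?_, ⟨l.length, ?_, ?_⟩, ?_⟩, hsupp⟩
  · rw [SimpleGraph.Walk.cons_isCycle_iff]
    refine ⟨hp.reverse, by simpa using hnp⟩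
  · simp [B, h3]
  · have : B.edgeSet ∩ hφ.matching.edgeSet =
        ((p.edges.filter (· ∈ hφ.matching.edgeSet)).toFinset : Set (Sym2 V)) := by
      ext e
      simp only [SimpleGraph.Walk.edgeSet, Set.mem_inter_iff, Set.mem_ofPred_eq, B,
        SimpleGraph.Walk.edges_cons, SimpleGraph.Walk.edges_reverse, List.mem_cons,
        List.mem_reverse, List.coe_toFinset, List.mem_filter, decide_eq_true_eq]
      constructor
      · rintro ⟨rfl | h, h'⟩
        · exact absurd h' hne
        · exact ⟨h, h'⟩
      · exact fun h => ⟨Or.inr h.1, h.2⟩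
    rw [this, Set.ncard_coe_finset,
      List.toFinset_card_of_nodup (hp.isTrail.edges_nodup.filter _), ← List.countP_eq_length_filter]
    exact h6
  · intro w hw hadj
    obtain ⟨h, h'⟩ := hφ.matching_adj.1 hadj
    rw [hsupp, ← h, hφ.edge_apply] at hw
    rcases hw with hw | hw
    · exact h' (by rw [← h, hw])
    · exact hx hw

/-- The stem is built from the unmatched end towards the base and then reversed; for `T = []` it is
trivial and `b = u`. -/
lemma inFlower {T l : List V} {u b : V} (hu : φ u = u) (hT : (u :: T).IsChain (Arc G φ))
    (hTm : ∀ y ∈ T, φ y ≠ y) (hTn : ((u :: T).map (edge φ)).Nodup)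
    (hb : (u :: T).getLast? = some b)
    (hl : (b :: (l ++ [φ b])).IsChain (Arc G φ)) (hlm : ∀ y ∈ l, φ y ≠ y)
    (hln : (l.map (edge φ)).Nodup) (hd : ∀ y ∈ l, edge φ y ∉ (u :: T).map (edge φ))
    {w : V} (hw : edge φ w ∈ (u :: (T ++ l)).map (edge φ)) : InFlower hφ.matching w := by
  have hbm : b ∈ u :: T := List.mem_of_getLast? hb
  obtain ⟨B, hB, hBs⟩ := hφ.exists_blossom hl hlm (by
    rw [List.map_cons, List.nodup_cons]
    refine ⟨fun h => ?_, hln⟩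
    obtain ⟨y, hy, hyb⟩ := List.mem_map.1 h
    exact hd y hy (hyb ▸ List.mem_map_of_mem hbm))
  obtain ⟨p, h1, h2, h3, h4, h5, -⟩ := hφ.exists_walk hT hTm hb
  have hps : ∀ w, w ∈ p.support ↔ edge φ w ∈ (u :: T).map (edge φ) := by
    intro w
    rw [h1, List.mem_cons, hφ.mem_flatMap_iff, List.map_cons, List.mem_cons, hφ.edge_eq_iff, hu,
      or_self]
  refine ⟨b, u, B, p.reverse, ⟨hB, ?_, ?_, ?_, ?_, ?_⟩, ?_⟩
  · rw [List.map_cons, List.nodup_cons] at hTn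
    apply SimpleGraph.Walk.IsPath.reverse
    rw [SimpleGraph.Walk.isPath_def, h1, List.nodup_cons, hφ.mem_flatMap_iff]
    exact ⟨hTn.1, hφ.nodup_flatMap hTm hTn.2⟩
  · unfold IsAlternatingWalk at h2 ⊢
    rw [SimpleGraph.Walk.edges_reverse, List.isChain_reverse]
    exact h2.imp fun _ _ h => by tauto
  · simp [h3]
  · exact hφ.notMem_support_matching.2 hu
  · intro w hw hw'
    rw [SimpleGraph.Walk.support_reverse, List.mem_reverse, hps] at hw'
    rcases (hBs w).1 hw with h | h
    · exact h
    · obtain ⟨y, hy, hyw⟩ := List.mem_map.1 h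
      exact absurd (hyw ▸ hw') (hd y hy)
  · rw [SimpleGraph.Walk.support_reverse, List.mem_reverse, hps, hBs]
    rw [← List.cons_append, List.map_append, List.mem_append] at hw
    tauto

/-- `T` expands to a path from `φ a` to `b` whose end edges are matching edges. The blossoms may
overlap each other. They are distinct, since the first one meets the path only in `φ a` and so
misses `b`. -/
lemma inTposy {T l₁ l₂ : List V} {a b : V} (hT : T.IsChain (Arc G φ))
    (hTm : ∀ y ∈ T, φ y ≠ y) (hTn : (T.map (edge φ)).Nodup)
    (ha : T.head? = some a) (hb : T.getLast? = some b)
    (hl₁ : (φ a :: (l₁ ++ [φ (φ a)])).IsChain (Arc G φ)) (hlm₁ : ∀ y ∈ l₁, φ y ≠ y)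
    (hln₁ : (l₁.map (edge φ)).Nodup) (hd₁ : ∀ y ∈ l₁, edge φ y ∉ T.map (edge φ))
    (hl₂ : (b :: (l₂ ++ [φ b])).IsChain (Arc G φ)) (hlm₂ : ∀ y ∈ l₂, φ y ≠ y)
    (hln₂ : (l₂.map (edge φ)).Nodup) (hd₂ : ∀ y ∈ l₂, edge φ y ∉ T.map (edge φ))
    {w : V} (hw : edge φ w ∈ (l₁ ++ (T ++ l₂)).map (edge φ)) : InTposy hφ.matching w := by
  have hbm : b ∈ T := List.mem_of_getLast? hb
  obtain ⟨T', rfl⟩ : ∃ T', T = a :: T' := by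
    cases T with
    | nil => simp at ha
    | cons c T' => exact ⟨T', by simpa using ha⟩
  have key : ∀ {c : V} {l : List V}, edge φ c ∈ (a :: T').map (edge φ) →
      (∀ y ∈ l, edge φ y ∉ (a :: T').map (edge φ)) → (l.map (edge φ)).Nodup →
      ((c :: l).map (edge φ)).Nodup := by
    intro c l hc hd hn
    rw [List.map_cons, List.nodup_cons]
    refine ⟨fun h => ?_, hn⟩
    obtain ⟨y, hy, hyb⟩ := List.mem_map.1 h
    exact hd y hy (hyb ▸ hc)
  obtain ⟨B₁, hB₁, hs₁⟩ := hφ.exists_blossom hl₁ hlm₁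
    (key (by simp [hφ.edge_apply]) hd₁ hln₁)
  obtain ⟨B₂, hB₂, hs₂⟩ := hφ.exists_blossom hl₂ hlm₂ (key (List.mem_map_of_mem hbm) hd₂ hln₂)
  obtain ⟨p, h1, h2, h3, h4, h5, -⟩ := hφ.exists_walk hT (fun y hy => hTm y (by simp [hy])) hb
  have haa : G.Adj (φ a) a := (hφ.adj a (hTm a (by simp))).symm
  have hae : s(φ a, a) ∈ hφ.matching.edgeSet := by
    rw [hφ.mem_edgeSet_matching]
    exact ⟨hφ.invol a, hTm a (by simp)⟩
  let P : G.Walk (φ a) b := .cons haa p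
  have hPs : P.support = (a :: T').flatMap (fun y => [φ y, y]) := by simp [P, h1]
  have hPm : ∀ w, w ∈ P.support ↔ edge φ w ∈ (a :: T').map (edge φ) := by
    intro w
    rw [hPs, hφ.mem_flatMap_iff]
  have hPp : P.IsPath := by
    rw [SimpleGraph.Walk.isPath_def, hPs]
    exact hφ.nodup_flatMap hTm hTn
  have hoff : ∀ {c : V} {l : List V} {w : V}, (∀ y ∈ l, edge φ y ∉ (a :: T').map (edge φ)) →
      w ∈ P.support → (w = c ∨ edge φ w ∈ l.map (edge φ)) → w = c := by
    intro c l w hd hP hw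
    rcases hw with h | h
    · exact h
    · obtain ⟨y, hy, hyw⟩ := List.mem_map.1 h
      exact absurd (hyw ▸ (hPm w).1 hP) (hd y hy)
  have hba : φ a ≠ b := by
    intro h
    have hn : P.support.Nodup := hPp.support_nodup
    rw [SimpleGraph.Walk.support_cons, List.nodup_cons] at hn
    exact hn.1 (by rw [h]; exact p.end_mem_support)
  refine ⟨φ a, b, B₁, P, B₂, ⟨⟨hB₁, hB₂, ?_, hPp, ⟨?_, ?_, ?_⟩, ?_⟩, ?_⟩, ?_⟩
  · intro h
    have hmem : b ∈ B₁.support := by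
      rw [← SimpleGraph.Walk.mem_verts_toSubgraph, h, SimpleGraph.Walk.mem_verts_toSubgraph]
      exact B₂.start_mem_support
    exact hba.symm (hoff hd₁ P.end_mem_support ((hs₁ b).1 hmem))
  · unfold IsAlternatingWalk at h2 ⊢
    simp only [P, SimpleGraph.Walk.edges_cons]
    rw [List.isChain_cons]
    exact ⟨fun e he => by simp [hae, h4 e he], h2⟩
  · exact ⟨_, by simp [P], hae⟩
  · cases hp : p.edges with
    | nil => exact ⟨s(φ a, a), by simp [P, hp], hae⟩
    | cons e t =>
      obtain ⟨f, hf⟩ : ∃ f, p.edges.getLast? = some f :=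
        ⟨_, List.getLast?_eq_some_getLast (by simp [hp])⟩
      refine ⟨f, ?_, h5 f hf⟩
      simp only [P, SimpleGraph.Walk.edges_cons, hp, List.getLast?_cons_cons]
      rw [← hp]; exact hf
  · simp [P, h3]
  · exact fun w hw h1 h2 => ⟨fun h => h1 (hoff hd₁ hw ((hs₁ w).1 h)),
      fun h => h2 (hoff hd₂ hw ((hs₂ w).1 h))⟩
  · rw [hPm, hs₁, hs₂]
    rw [List.map_append, List.mem_append, List.map_append, List.mem_append] at hw
    tauto

end IsMate

/-! ### Augmenting paths, and combining the two ends of a path -/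

/-- Berge's argument one arc at a time: the exposed vertex slides along the path until it is
adjacent to `u'`, when an edge can be added. -/
lemma IsMaxMate.not_augmenting [Finite V] {φ : Equiv.Perm V} (hφ : IsMaxMate G φ) {T : List V}
    {u u' : V} (hu : φ u = u) (hu' : φ u' = u') (hne : u ≠ u')
    (hT : (u :: (T ++ [u'])).IsChain (Arc G φ)) (hTm : ∀ y ∈ T, φ y ≠ y)
    (hTn : (T.map (edge φ)).Nodup) : False := by
  classical
  induction T generalizing φ u with
  | nil =>
    have hadj : G.Adj u u' := by
      simp only [List.nil_append, List.isChain_cons_cons] at hT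
      have := hT.1.1
      rwa [hu'] at this
    have hval : ∀ x, x ≠ u → x ≠ u' → (φ * Equiv.swap u u') x = φ x := by
      intro x h h'
      simp [Equiv.swap_apply_of_ne_of_ne h h']
    have h1 : (φ * Equiv.swap u u') u = u' := by simp [hu']
    have h2 : (φ * Equiv.swap u u') u' = u := by simp [hu]
    have hψ : IsMate G (φ * Equiv.swap u u') := by
      constructor
      · intro x
        by_cases hx : x = u
        · rw [hx, h1, h2]
        by_cases hx' : x = u'
        · rw [hx', h2, h1]
        rw [hval x hx hx', hval, hφ.1.invol]
        · rwa [Ne, hφ.1.apply_eq_iff, hu]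
        · rwa [Ne, hφ.1.apply_eq_iff, hu']
      · intro x h
        by_cases hx : x = u
        · rw [hx, h1]; exact hadj
        by_cases hx' : x = u'
        · rw [hx', h2]; exact hadj.symm
        rw [hval x hx hx'] at h ⊢
        exact hφ.1.adj x h
    have := hφ.2 _ hψ
    refine absurd this (not_le.2 (Set.ncard_lt_ncard ?_))
    rw [Set.ssubset_iff_of_subset]
    · exact ⟨u, by simpa [hu'] using hne.symm, by simpa using hu⟩
    · intro x hx
      have hx' : φ x ≠ x := hx
      change (φ * Equiv.swap u u') x ≠ x
      rw [hval]
      · exact hx'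
      · rintro rfl; exact hx' hu
      · rintro rfl; exact hx' hu'
  | cons y T ih =>
    rw [List.cons_append, List.isChain_cons_cons] at hT
    have hy : φ y ≠ y := hTm y (by simp)
    have hyu : y ≠ u := hT.1.2.symm
    have hyu' : φ y ≠ u := fun h => hyu (by rw [← hφ.1.invol y, h, hu])
    -- The edge from `u` to `φ y` replaces the one from `y` to `φ y`, so `y` is exposed instead of
    -- `u`.
    set ψ : Equiv.Perm V := (Equiv.swap u y)⁻¹ * φ * Equiv.swap u y with hψ
    have h1 : ψ u = φ y := by simp [hψ, Equiv.swap_apply_of_ne_of_ne hyu' hy]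
    have h2 : ψ y = y := by simp [hψ, hu]
    have h3 : ψ (φ y) = u := by
      simp [hψ, Equiv.swap_apply_of_ne_of_ne hyu' hy, hφ.1.invol]
    have h4 : ∀ x, x ≠ u → x ≠ y → x ≠ φ y → ψ x = φ x := by
      intro x hx hxy hxy'
      simp only [hψ, Equiv.Perm.mul_apply, Equiv.swap_inv, Equiv.swap_apply_of_ne_of_ne hx hxy]
      apply Equiv.swap_apply_of_ne_of_ne
      · rwa [Ne, hφ.1.apply_eq_iff, hu]
      · rwa [Ne, hφ.1.apply_eq_iff]
    have hmate : IsMate G ψ := by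
      constructor
      · intro x
        simp [hψ, hφ.1.invol]
      · intro x hx
        by_cases hxu : x = u
        · rw [hxu, h1]; exact hT.1.1
        by_cases hxy : x = y
        · exact absurd h2 (hxy ▸ hx)
        by_cases hxy' : x = φ y
        · rw [hxy', h3]; exact hT.1.1.symm
        rw [h4 x hxu hxy hxy'] at hx ⊢
        exact hφ.1.adj x hx
    have hyT : ∀ z ∈ T, ψ z = φ z ∧ z ≠ y := by
      intro z hz
      rw [List.map_cons, List.nodup_cons, List.mem_map] at hTn
      have hzy : z ≠ y ∧ z ≠ φ y := by
        rw [← not_or, ← hφ.1.edge_eq_iff]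
        exact fun h => hTn.1 ⟨z, hz, h⟩
      refine ⟨h4 z ?_ hzy.1 hzy.2, hzy.1⟩
      rintro rfl
      exact hTm z (by simp [hz]) hu
    have hu'y : u' ≠ y := by rintro rfl; exact hy hu'
    have hψu' : ψ u' = u' := by
      rw [h4 u' hne.symm hu'y, hu']
      exact fun h => hu'y (by rw [← hφ.1.invol y, ← h, hu'])
    refine ih (φ := ψ) (u := y) (hφ.conj hmate) h2 hψu' hu'y.symm ?_ ?_ ?_
    · refine hT.2.imp_of_mem_tail_imp ?_
      intro a b _ hb hab
      refine ⟨?_, hab.2⟩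
      have : ψ b = φ b := by
        rw [List.tail_cons, List.mem_append, List.mem_singleton] at hb
        rcases hb with hb | rfl
        · exact (hyT b hb).1
        · rw [hψu', hu']
      rw [this]; exact hab.1
    · intro z hz
      rw [(hyT z hz).1]
      exact hTm z (by simp [hz])
    · rw [List.map_cons, List.nodup_cons] at hTn
      rw [List.map_congr_left (g := edge φ) (fun z hz => by simp [edge, (hyT z hz).1])]
      exact hTn.2

/-- The token path `T` ends at `b` with a blossom `l` based at `b` and disjoint from `T`, or with an
unmatched vertex. -/
def Terminal (G : SimpleGraph V) (φ : Equiv.Perm V) (T : List V) (b : V) (l : List V) : Prop :=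
  (∃ u, l = [u] ∧ φ u = u ∧ Arc G φ b u) ∨
    ((b :: (l ++ [φ b])).IsChain (Arc G φ) ∧ (∀ y ∈ l, φ y ≠ y) ∧ (l.map (edge φ)).Nodup ∧
      ∀ y ∈ l, edge φ y ∉ T.map (edge φ))

/-- Two blossoms give a Tposy, one gives a flower. With none, the unmatched ends coincide, as the
path would otherwise be augmenting; `T` itself is then a blossom based at that unmatched vertex. -/
lemma IsMaxMate.inFlower_or_inTposy [Finite V] {φ : Equiv.Perm V} (hφ : IsMaxMate G φ)
    {T l₁ l₂ : List V} {a b : V} (hT : T.IsChain (Arc G φ))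
    (hTm : ∀ y ∈ T, φ y ≠ y) (hTn : (T.map (edge φ)).Nodup)
    (ha : T.head? = some a) (hb : T.getLast? = some b)
    (h₁ : Terminal G φ T (φ a) l₁) (h₂ : Terminal G φ T b l₂)
    {w : V} (hw : edge φ w ∈ (l₁ ++ (T ++ l₂)).map (edge φ)) :
    InFlower hφ.1.matching w ∨ InTposy hφ.1.matching w := by
  have hue : ∀ {u : V}, φ u = u → edge φ u ∉ T.map (edge φ) := by
    intro u hu h
    obtain ⟨y, hy, hyu⟩ := List.mem_map.1 h
    rw [hφ.1.edge_eq_iff, hu, or_self] at hyu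
    exact hTm y hy (hyu ▸ hu)
  have hcons : ∀ {u : V}, Arc G φ (φ a) u → φ u = u → (u :: T).IsChain (Arc G φ) := by
    intro u h hu
    rw [List.isChain_cons]
    refine ⟨fun y hy => ?_, hT⟩
    rw [ha] at hy
    obtain rfl : a = y := by simpa using hy
    have := hφ.1.arc_mirror h
    rwa [hφ.1.invol, hu] at this
  have hlast : ∀ u : V, (u :: T).getLast? = some b := by
    intro u
    rw [List.getLast?_cons, hb]
    rfl
  rcases h₁ with ⟨u, rfl, hu, hua⟩ | ⟨hc₁, hm₁, hn₁, hd₁⟩ <;>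
    rcases h₂ with ⟨u', rfl, hu', hub⟩ | ⟨hc₂, hm₂, hn₂, hd₂⟩
  · have hch : (u :: (T ++ [u'])).IsChain (Arc G φ) := by
      rw [← List.cons_append, List.isChain_append]
      refine ⟨hcons hua hu, by simp, ?_⟩
      intro x hx y hy
      rw [hlast] at hx
      obtain rfl : b = x := by simpa using hx
      obtain rfl : u' = y := by simpa using hy
      exact hub
    by_cases h : u = u'
    · subst h
      left
      refine hφ.1.inFlower (u := u) (b := u) (T := []) (l := T) hu (by simp) (by simp) (by simp)
        (by simp) (by rwa [hu]) hTm hTn ?_ ?_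
      · intro y hy h
        simp only [List.map_cons, List.map_nil, List.mem_singleton] at h
        exact hue hu (h ▸ List.mem_map_of_mem hy)
      · simp at hw ⊢; tauto
    · exact (hφ.not_augmenting hu hu' h hch hTm hTn).elim
  · left
    refine hφ.1.inFlower (u := u) (b := b) (T := T) (l := l₂) hu (hcons hua hu) hTm
      (by rw [List.map_cons, List.nodup_cons]; exact ⟨hue hu, hTn⟩) (hlast u) hc₂ hm₂ hn₂ ?_
      (by simpa using hw)
    intro y hy h
    rw [List.map_cons, List.mem_cons, hφ.1.edge_eq_iff, hu, or_self] at h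
    rcases h with rfl | h
    · exact hm₂ y hy hu
    · exact hd₂ y hy h
  · left
    refine hφ.1.inFlower (u := u') (b := φ a) (T := mirror φ T) (l := l₁) hu' ?_ ?_ ?_ ?_ hc₁ hm₁
      hn₁ ?_ ?_
    · rw [List.isChain_cons]
      refine ⟨fun y hy => ?_, hφ.1.isChain_mirror hT⟩
      have : y = φ b := by simpa [mirror, hb] using hy.symm
      rw [this]
      have := hφ.1.arc_mirror hub
      rwa [hu'] at this
    · intro y hy
      rw [hφ.1.mem_mirror] at hy
      exact fun h => hTm _ hy (by rw [h, h])
    · rw [List.map_cons, List.nodup_cons, hφ.1.edge_mem_mirror, hφ.1.nodup_edge_mirror]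
      exact ⟨hue hu', hTn⟩
    · rw [List.getLast?_cons]
      simp [mirror, ha]
    · intro y hy h
      rw [List.map_cons, List.mem_cons, hφ.1.edge_mem_mirror, hφ.1.edge_eq_iff, hu', or_self] at h
      rcases h with rfl | h
      · exact hm₁ y hy hu'
      · exact hd₁ y hy h
    · simp only [List.map_append, List.mem_append, List.map_cons, List.mem_cons,
        hφ.1.edge_mem_mirror, List.map_nil, List.not_mem_nil, or_false] at hw ⊢
      tauto
  · right
    exact hφ.1.inTposy hT hTm hTn ha hb hc₁ hm₁ hn₁ hd₁ hc₂ hm₂ hn₂ hd₂ hw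

/-! ### Vertices of Jflowers and Jposies are bireachable -/

/-- Marked entries are never adjacent and never at an end, so fewer than half are marked, and the
extreme count forces alternation. The definition of a blossom only gives the count of matching
edges; this recovers the alternation. -/
lemma two_mul_countP_lt_length {α : Type*} (p : α → Bool) : ∀ (l : List α), l ≠ [] →
    l.IsChain (fun e f => ¬ (p e ∧ p f)) → (∀ e ∈ l.head?, ¬ p e) → (∀ e ∈ l.getLast?, ¬ p e) →
    2 * l.countP p + 1 ≤ l.length ∧
      (l.length = 2 * l.countP p + 1 → l.IsChain (fun e f => (p e ↔ ¬ p f)))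
  | [], h, _, _, _ => absurd rfl h
  | [e], _, _, h1, _ => by
    have : ¬ p e := h1 e (by simp)
    simp [this]
  | e :: f :: t, _, hc, h1, h2 => by
    have he : ¬ p e := h1 e (by simp)
    rw [List.isChain_cons_cons] at hc
    by_cases hf : p f
    · have ht : t ≠ [] := by
        rintro rfl
        exact h2 f (by simp) hf
      have hc' := List.isChain_cons.1 hc.2
      obtain ⟨h3, h4⟩ := two_mul_countP_lt_length p t ht hc'.2
        (fun e he h => hc'.1 e he ⟨hf, h⟩)
        (fun e he => h2 e (by
          obtain ⟨b, t, rfl⟩ := List.exists_cons_of_ne_nil ht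
          simpa [List.getLast?_cons_cons] using he))
      rw [List.countP_cons_of_neg he, List.countP_cons_of_pos hf, List.length_cons,
        List.length_cons]
      refine ⟨by omega, fun h => ?_⟩
      rw [List.isChain_cons_cons, List.isChain_cons]
      refine ⟨by simp [he, hf], fun e he => ?_, h4 (by omega)⟩
      have := hc'.1 e he
      tauto
    · obtain ⟨h3, -⟩ := two_mul_countP_lt_length p (f :: t) (by simp) hc.2 (by simpa using hf)
        (fun e he => h2 e (by simpa [List.getLast?_cons_cons] using he))
      rw [List.countP_cons_of_neg he, List.length_cons]
      exact ⟨by omega, fun h => by omega⟩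

namespace IsMate

variable {φ : Equiv.Perm V} (hφ : IsMate G φ)
include hφ

lemma isChain_of_isTrail {a c : V} (p : G.Walk a c) (hp : p.IsTrail) :
    p.edges.IsChain fun e f => ¬ (e ∈ hφ.matching.edgeSet ∧ f ∈ hφ.matching.edgeSet) := by
  induction p with
  | nil => simp
  | cons h p ih =>
    rw [SimpleGraph.Walk.isTrail_cons] at hp
    rw [SimpleGraph.Walk.edges_cons, List.isChain_cons]
    refine ⟨?_, ih hp.1⟩
    cases p with
    | nil => simp
    | cons h' p =>
      rename_i x y z w
      intro f hf
      obtain rfl : s(y, w) = f := by simpa using hf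
      rw [hφ.mem_edgeSet_matching, hφ.mem_edgeSet_matching]
      rintro ⟨⟨h1, -⟩, h2, -⟩
      apply hp.2
      rw [← h1, hφ.invol] at h2
      simp [← h1, ← h2, Sym2.eq_swap]

/-- The direction in which an alternating walk is at the vertex `a`; `s` tells whether the next
edge is in the matching. -/
def token (φ : Equiv.Perm V) (s : Bool) (a : V) : V := if s then φ a else a

omit hφ in
lemma token_eq (s : Bool) (a : V) : token φ s a = a ∨ token φ s a = φ a := by
  cases s <;> simp [token]

/-- A non-matching edge advances by one arc. A matching edge from `x` to `y` changes nothing, since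
`φ x` and `y` are the same token. Each edge flips the bit, hence the parity of the length in the
final token. -/
lemma reflTransGen_of_alternating {a c : V} (p : G.Walk a c) (s : Bool)
    (hp : IsAlternatingWalk hφ.matching p)
    (hs : ∀ e ∈ p.edges.head?, (e ∈ hφ.matching.edgeSet ↔ s)) {w : V} (hw : w ∈ p.support) :
    ∃ w', (w' = w ∨ w' = φ w) ∧ ReflTransGen (Arc G φ) (token φ s a) w' ∧
      ReflTransGen (Arc G φ) w' (token φ (s ^^ decide (Odd p.length)) c) := by
  induction p generalizing s w with
  | nil =>
    obtain rfl : w = _ := by simpa using hw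
    exact ⟨_, token_eq s w, .refl, by simpa using .refl⟩
  | cons h p ih =>
    rename_i x y z
    unfold IsAlternatingWalk at hp
    rw [SimpleGraph.Walk.edges_cons, List.isChain_cons] at hp
    have hxy : s(x, y) ∈ hφ.matching.edgeSet ↔ s := hs _ (by simp)
    have key := fun {w} => ih (!s) (w := w) hp.2 (fun e he => by
      have := hp.1 e he
      rw [hxy] at this
      cases s <;> simp_all)
    have hstep : ReflTransGen (Arc G φ) (token φ s x) (token φ (!s) y) := by
      rw [hφ.mem_edgeSet_matching] at hxy
      cases s
      · refine .single ⟨?_, ?_⟩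
        · simpa [token, hφ.invol] using h
        · intro h'
          simp only [token, Bool.not_false, if_true, Bool.false_eq_true, if_false] at h'
          have h2 : φ x = y := by rw [h', hφ.invol]
          simpa using hxy.1 ⟨h2, h.ne⟩
      · have := (hxy.2 rfl).1
        simp only [token, Bool.not_true, if_true, Bool.false_eq_true, if_false, this]
        exact .refl
    have hend : (s ^^ decide (Odd (SimpleGraph.Walk.cons h p).length)) =
        ((!s) ^^ decide (Odd p.length)) := by
      rw [SimpleGraph.Walk.length_cons]
      by_cases ho : Odd p.length
      · have : ¬ Odd (p.length + 1) := by simpa [Nat.odd_add_one] using ho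
        simp [ho, this]
      · have : Odd (p.length + 1) := by simpa [Nat.odd_add_one] using ho
        simp [ho, this]
    rw [hend]
    rw [SimpleGraph.Walk.support_cons, List.mem_cons] at hw
    rcases hw with rfl | hw
    · obtain ⟨w', -, h1, h2⟩ := key p.start_mem_support
      exact ⟨_, token_eq s w, .refl, hstep.trans (h1.trans h2)⟩
    · obtain ⟨w', h0, h1, h2⟩ := key hw
      exact ⟨w', h0, hstep.trans h1, h2⟩

/-- Going once round the odd cycle turns the walk round: it enters at `b` along the matching edge
and is ready to leave along the same edge. -/
lemma reflTransGen_of_isBlossom {b : V} {B : G.Walk b b} (hB : IsBlossom hφ.matching B) {w : V}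
    (hw : w ∈ B.support) : ∃ w', (w' = w ∨ w' = φ w) ∧ ReflTransGen (Arc G φ) b w' ∧
      ReflTransGen (Arc G φ) w' (φ b) := by
  classical
  obtain ⟨hc, ⟨k, hk, hk'⟩, hb⟩ := hB
  have hne : B.edges ≠ [] := by
    intro h
    have := congrArg List.length h
    rw [SimpleGraph.Walk.length_edges, hk] at this
    simp at this
  have hfirst : ∀ (C : G.Walk b b), (∀ w ∈ C.support, w ∈ B.support) →
      ∀ e ∈ C.edges.head?, e ∉ hφ.matching.edgeSet := by
    intro C hC e he
    cases C with
    | nil => simp at he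
    | cons h p =>
      obtain rfl : s(b, _) = e := by simpa using he
      rw [SimpleGraph.Subgraph.mem_edgeSet]
      exact hb _ (hC _ (by simp))
  have h1 := hfirst B (fun _ h => h)
  have h2 : ∀ e ∈ B.edges.getLast?, e ∉ hφ.matching.edgeSet := by
    have := hfirst B.reverse (by simp)
    simpa using this
  have hcount : (B.edges.countP (· ∈ hφ.matching.edgeSet)) = k := by
    rw [← hk', List.countP_eq_length_filter,
      ← List.toFinset_card_of_nodup (hc.isTrail.edges_nodup.filter _), ← Set.ncard_coe_finset]
    congr 1
    ext e
    simp [SimpleGraph.Walk.edgeSet]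
  have halt : IsAlternatingWalk hφ.matching B := by
    have := (two_mul_countP_lt_length (fun e => decide (e ∈ hφ.matching.edgeSet)) B.edges hne
      ((hφ.isChain_of_isTrail B hc.isTrail).imp (by simp)) (by simpa using h1)
      (by simpa using h2)).2 (by rw [SimpleGraph.Walk.length_edges, hcount, hk])
    exact this.imp (by simp)
  obtain ⟨w', h0, h3, h4⟩ := hφ.reflTransGen_of_alternating B false halt
    (fun e he => by simp [h1 e he]) hw
  refine ⟨w', h0, by simpa [token] using h3, ?_⟩
  have : Odd B.length := ⟨k, hk⟩
  simpa [token, this] using h4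

/-- A vertex whose matching edge can be traversed in both directions by one closed alternating
walk. -/
def Bireachable (G : SimpleGraph V) (φ : Equiv.Perm V) (v : V) : Prop :=
  TransGen (Arc G φ) v (φ v) ∧ TransGen (Arc G φ) (φ v) v

/-- All tokens concerned lie in one strong component, which is closed under mirroring. The second
token in `hne` makes the walks nonempty, which matters when `w` is unmatched. -/
lemma bireachable_of_reflTransGen {x w w' : V} (hx : ReflTransGen (Arc G φ) x (φ x))
    (hx' : ReflTransGen (Arc G φ) (φ x) x) (hw : w' = w ∨ w' = φ w)
    (h1 : ReflTransGen (Arc G φ) x w') (h2 : ReflTransGen (Arc G φ) w' x)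
    (hne : ∃ y ≠ w', ReflTransGen (Arc G φ) x y ∧ ReflTransGen (Arc G φ) y x) :
    Bireachable G φ w := by
  have h3 := hφ.reflTransGen_mirror h1
  have h4 := hφ.reflTransGen_mirror h2
  have h5 : ReflTransGen (Arc G φ) w' (φ w') := h2.trans (hx.trans h4)
  have h6 : ReflTransGen (Arc G φ) (φ w') w' := h3.trans (hx'.trans h1)
  obtain ⟨y, hy, h7, h8⟩ := hne
  have h9 : TransGen (Arc G φ) w' w' := by
    have h10 : TransGen (Arc G φ) w' y :=
      (reflTransGen_iff_eq_or_transGen.1 (h2.trans h7)).resolve_left hy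
    exact h10.trans_left (h8.trans h1)
  have h11 : TransGen (Arc G φ) w' (φ w') := h9.trans_left h5
  have h12 : TransGen (Arc G φ) (φ w') w' := TransGen.trans_right h6 h9
  rcases hw with rfl | rfl
  · exact ⟨h11, h12⟩
  · rw [hφ.invol] at h11 h12
    exact ⟨h12, h11⟩

/-- The unmatched end `u` is its own mirror image: run from it to the base, round the blossom, and
back. -/
lemma bireachable_of_inJflower {w : V} (h : InJflower hφ.matching w) : Bireachable G φ w := by
  obtain ⟨b, u, B, W, ⟨hB, hW, hev, hu⟩, hw⟩ := h
  rw [hφ.notMem_support_matching] at hu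
  have hWr : ∀ w ∈ W.support, ∃ w', (w' = w ∨ w' = φ w) ∧ ReflTransGen (Arc G φ) u w' ∧
      ReflTransGen (Arc G φ) w' b := by
    intro w hw
    obtain ⟨w', h0, h1, h2⟩ := hφ.reflTransGen_of_alternating W.reverse false (by
        unfold IsAlternatingWalk at hW ⊢
        rw [SimpleGraph.Walk.edges_reverse, List.isChain_reverse]
        exact hW.imp fun _ _ h => by tauto) (by
        intro e he
        simp only [Bool.false_eq_true, iff_false]
        cases hr : W.reverse with
        | nil => simp [hr] at he
        | cons h p =>
          rw [hr] at he
          obtain rfl : s(u, _) = e := by simpa using he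
          rw [hφ.mem_edgeSet_matching]
          rintro ⟨h1, h2⟩
          exact h2 (hu ▸ h1)) (w := w) (by simpa using hw)
    refine ⟨w', h0, by simpa [token] using h1, ?_⟩
    have : ¬ Odd W.length := by simpa using hev
    simpa [token, this] using h2
  have hub : ReflTransGen (Arc G φ) u b := by
    obtain ⟨w', -, h1, h2⟩ := hWr u W.end_mem_support
    exact h1.trans h2
  have hbu : ReflTransGen (Arc G φ) (φ b) u := by
    have := hφ.reflTransGen_mirror hub
    rwa [hu] at this
  have hBr := fun {w} => hφ.reflTransGen_of_isBlossom hB (w := w)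
  have hbb : ReflTransGen (Arc G φ) b (φ b) := by
    obtain ⟨w', -, h1, h2⟩ := hBr B.start_mem_support
    exact h1.trans h2
  -- If the base is `u` itself, the second token comes from a neighbour of the base on the blossom.
  have hne : ∀ z, ∃ y ≠ z, ReflTransGen (Arc G φ) u y ∧ ReflTransGen (Arc G φ) y u := by
    intro z
    by_cases hz : z = u
    · subst hz
      by_cases hb : b = z
      · subst hb
        obtain ⟨k, hk, -⟩ := hB.2.1
        have h3 := hB.1.three_le_length
        cases hBc : B with
        | nil => simp [hBc] at h3
        | cons hadj p =>
          rename_i y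
          obtain ⟨w', h0, h1, h2⟩ := hBr (w := y) (by simp [hBc])
          refine ⟨w', ?_, h1, h2.trans hbu⟩
          rintro rfl
          rcases h0 with h0 | h0
          · exact hadj.ne h0
          · rw [eq_comm, hφ.apply_eq_iff, hu] at h0
            exact hadj.ne h0.symm
      · exact ⟨b, hb, hub, hbb.trans hbu⟩
    · exact ⟨u, Ne.symm hz, .refl, .refl⟩
  rcases hw with hw | hw
  · obtain ⟨w', h0, h1, h2⟩ := hBr hw
    exact hφ.bireachable_of_reflTransGen (x := u) (by rw [hu]) (by rw [hu]) h0 (hub.trans h1)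
      (h2.trans hbu) (hne w')
  · obtain ⟨w', h0, h1, h2⟩ := hWr w hw
    exact hφ.bireachable_of_reflTransGen (x := u) (by rw [hu]) (by rw [hu]) h0 h1
      (h2.trans (hbb.trans hbu)) (hne w')

/-- The closed walk runs along `W`, round `B₂`, back along `W` and round `B₁`. -/
lemma bireachable_of_inJposy {w : V} (h : InJposy hφ.matching w) : Bireachable G φ w := by
  obtain ⟨b₁, b₂, B₁, W, B₂, ⟨hB₁, hB₂, ⟨hW, hWf, -⟩, hodd⟩, hw⟩ := h
  obtain ⟨e, he, heM⟩ := hWf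
  have hs : ∀ f ∈ W.edges.head?, (f ∈ hφ.matching.edgeSet ↔ true) := by
    intro f hf
    obtain rfl : e = f := Option.mem_unique he hf
    simpa using heM
  have hWr : ∀ w ∈ W.support, ∃ w', (w' = w ∨ w' = φ w) ∧ ReflTransGen (Arc G φ) (φ b₁) w' ∧
      ReflTransGen (Arc G φ) w' b₂ := by
    intro w hw
    obtain ⟨w', h0, h1, h2⟩ := hφ.reflTransGen_of_alternating W true hW hs hw
    exact ⟨w', h0, by simpa [token] using h1, by simpa [token, hodd] using h2⟩
  have hBr₁ := fun {w} => hφ.reflTransGen_of_isBlossom hB₁ (w := w)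
  have hBr₂ := fun {w} => hφ.reflTransGen_of_isBlossom hB₂ (w := w)
  have h11 : ReflTransGen (Arc G φ) b₁ (φ b₁) := by
    obtain ⟨w', -, h1, h2⟩ := hBr₁ B₁.start_mem_support
    exact h1.trans h2
  have h22 : ReflTransGen (Arc G φ) b₂ (φ b₂) := by
    obtain ⟨w', -, h1, h2⟩ := hBr₂ B₂.start_mem_support
    exact h1.trans h2
  have h12 : ReflTransGen (Arc G φ) (φ b₁) b₂ := by
    obtain ⟨w', -, h1, h2⟩ := hWr b₁ W.start_mem_support
    exact h1.trans h2
  have h21 : ReflTransGen (Arc G φ) (φ b₂) b₁ := by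
    have := hφ.reflTransGen_mirror h12
    rwa [hφ.invol] at this
  have hloop : ReflTransGen (Arc G φ) (φ b₁) b₁ := h12.trans (h22.trans h21)
  have hb₁ : φ b₁ ≠ b₁ := by
    cases hWc : W with
    | nil => simp [hWc] at he
    | cons h p =>
      rw [hWc] at he
      obtain rfl : s(b₁, _) = e := by simpa using he
      obtain ⟨h1, h2⟩ := (hφ.mem_edgeSet_matching).1 heM
      rw [h1]; exact h2.symm
  have hne : ∀ z, ∃ y ≠ z, ReflTransGen (Arc G φ) b₁ y ∧ ReflTransGen (Arc G φ) y b₁ := by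
    intro z
    by_cases hz : z = b₁
    · exact ⟨φ b₁, hz ▸ hb₁, h11, hloop⟩
    · exact ⟨b₁, Ne.symm hz, .refl, .refl⟩
  have hfin : ∀ w', (w' = w ∨ w' = φ w) → ReflTransGen (Arc G φ) b₁ w' →
      ReflTransGen (Arc G φ) w' b₁ → Bireachable G φ w := fun w' h0 h1 h2 =>
    hφ.bireachable_of_reflTransGen h11 hloop h0 h1 h2 (hne w')
  rcases hw with hw | hw | hw
  · obtain ⟨w', h0, h1, h2⟩ := hBr₁ hw
    exact hfin w' h0 h1 (h2.trans hloop)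
  · obtain ⟨w', h0, h1, h2⟩ := hWr w hw
    exact hfin w' h0 (h11.trans h1) (h2.trans (h22.trans h21))
  · obtain ⟨w', h0, h1, h2⟩ := hBr₂ hw
    exact hfin w' h0 (h11.trans (h12.trans h1)) (h2.trans h21)

end IsMate

/-! ### The inclusions that keep the matching fixed -/

lemma VT_subset_VESG : VT G ⊆ VESG G := by
  rintro v ⟨M, hM, h | ⟨b₁, b₂, B₁, P, B₂, h, hv⟩⟩
  · exact ⟨M, hM, .inl h⟩
  · exact ⟨M, hM, .inr ⟨b₁, b₂, B₁, P, B₂, h.1, hv⟩⟩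

lemma VESG_subset_VJ : VESG G ⊆ VJ G := by
  rintro v ⟨M, hM, ⟨b, u, B, S, h, hv⟩ | ⟨b₁, b₂, B₁, P, B₂, h, hv⟩⟩
  · exact ⟨M, hM, .inl ⟨b, u, B, S, ⟨h.1, h.2.2.1, h.2.2.2.1, h.2.2.2.2.1⟩, hv⟩⟩
  · exact ⟨M, hM, .inr ⟨b₁, b₂, B₁, P, B₂, ⟨h.1, h.2.1, h.2.2.2.2⟩, hv⟩⟩

/-! ### Sides and elementary sets -/

lemma reflTransGen_of_isChain {α : Type*} {R : α → α → Prop} {l : List α} {x y : α}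
    (h : (x :: (l ++ [y])).IsChain R) : ReflTransGen R x y := by
  induction l generalizing x with
  | nil => exact .single (by simpa using h)
  | cons a l ih =>
    rw [List.cons_append, List.isChain_cons_cons] at h
    exact .head h.1 (ih h.2)

lemma exists_first_mem {α : Type*} (p : α → Prop) (l : List α) :
    (∀ x ∈ l, ¬ p x) ∨ ∃ l₁ x l₂, l = l₁ ++ x :: l₂ ∧ (∀ y ∈ l₁, ¬ p y) ∧ p x := by
  induction l with
  | nil => simp
  | cons a l ih =>
    by_cases ha : p a
    · exact .inr ⟨[], a, l, rfl, by simp, ha⟩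
    rcases ih with h | ⟨l₁, x, l₂, rfl, h1, h2⟩
    · left
      intro x hx
      rcases List.mem_cons.1 hx with rfl | hx
      exacts [ha, h x hx]
    · refine .inr ⟨a :: l₁, x, l₂, rfl, ?_, h2⟩
      intro y hy
      rcases List.mem_cons.1 hy with rfl | hy
      exacts [ha, h1 y hy]

/-- A walk `c` leaving `P` at `q` and running outside of `P` and its partners. It ends at an
unmatched vertex, or closes a blossom based on itself, or returns to `P` from the other side. -/
structure Side (G : SimpleGraph V) (φ : Equiv.Perm V) (P : Set V) (q : V) (c : List V) : Prop where
  mem : q ∈ P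
  chain : (q :: c).IsChain (Arc G φ)
  nodup : (c.map (edge φ)).Nodup
  outside : ∀ y ∈ c, y ∉ P ∧ φ y ∉ P
  close : (∃ r u, c = r ++ [u] ∧ φ u = u ∧ ∀ y ∈ r, φ y ≠ y) ∨ ((∀ y ∈ c, φ y ≠ y) ∧
    ((∃ r l x, c = r ++ l ∧ (q :: r).getLast? = some x ∧
        (q :: (c ++ [φ x])).IsChain (Arc G φ)) ∨
      ∃ q' ∈ P, q' ≠ q ∧ (q :: (c ++ [φ q'])).IsChain (Arc G φ)))

/-- `P` contains at most one end of each matching edge, no unmatched vertex, and is strongly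
connected. -/
structure Elementary (G : SimpleGraph V) (φ : Equiv.Perm V) (P : Set V) : Prop where
  disj : ∀ x ∈ P, φ x ∉ P
  conn : ∀ x ∈ P, ∀ y ∈ P, ReflTransGen (fun a b => Arc G φ a b ∧ b ∈ P) x y

namespace IsMate

variable {φ : Equiv.Perm V} (hφ : IsMate G φ)
include hφ

/-- Invariant: `y` ends a path that has left `P` and since used distinct matching edges outside `P`
and `φ P`. A further arc either completes a side or keeps the invariant, after restarting if it
enters `P` and cutting if it repeats a vertex. -/
lemma exists_side_step {P : Set V} {y z : V}
    (hy : ∃ q ∈ P, ∃ c, (q :: c).IsChain (Arc G φ) ∧ (q :: c).getLast? = some y ∧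
      (c.map (edge φ)).Nodup ∧ (∀ x ∈ c, x ∉ P ∧ φ x ∉ P) ∧ ∀ x ∈ c, φ x ≠ x)
    (hyz : Arc G φ y z) :
    (∃ q c, Side G φ P q c) ∨ (φ z ∉ P ∧
    ∃ q ∈ P, ∃ c, (q :: c).IsChain (Arc G φ) ∧ (q :: c).getLast? = some z ∧
      (c.map (edge φ)).Nodup ∧ (∀ x ∈ c, x ∉ P ∧ φ x ∉ P) ∧ ∀ x ∈ c, φ x ≠ x) := by
  obtain ⟨q, hq, c, h1, h2, h3, h4, h5⟩ := hy
  have hc : (q :: (c ++ [z])).IsChain (Arc G φ) := by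
    rw [← List.cons_append, List.isChain_append]
    refine ⟨h1, by simp, ?_⟩
    intro a ha b hb
    obtain rfl : y = a := Option.mem_unique h2 ha
    obtain rfl : z = b := by simpa using hb
    exact hyz
  by_cases hz : φ z ∈ P
  · left
    refine ⟨q, c, hq, h1, h3, h4, .inr ⟨h5, ?_⟩⟩
    by_cases hzq : φ z = q
    · exact .inl ⟨[], c, q, rfl, by simp, by rw [← hzq, hφ.invol, hzq]; exact hc⟩
    · exact .inr ⟨φ z, hz, hzq, by rwa [hφ.invol]⟩
  by_cases hzP : z ∈ P
  · exact .inr ⟨hz, z, hzP, [], by simp⟩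
  by_cases hze : edge φ z ∈ c.map (edge φ)
  · obtain ⟨x, hx, hxz⟩ := List.mem_map.1 hze
    obtain ⟨c₁, c₂, rfl⟩ := List.append_of_mem hx
    rcases hφ.edge_eq_iff.1 hxz.symm with rfl | rfl
    · refine .inr ⟨hz, q, hq, c₁ ++ [z], h1.prefix ⟨c₂, by simp⟩, ?_, ?_, ?_, ?_⟩
      · rw [← List.cons_append, List.getLast?_append]; simp
      · rw [List.append_cons, List.map_append] at h3
        exact h3.of_append_left
      · exact fun x hx => h4 x (by simp at hx ⊢; tauto)
      · exact fun x hx => h5 x (by simp at hx ⊢; tauto)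
    · left
      refine ⟨q, _, hq, h1, h3, h4, .inr ⟨h5, .inl ⟨c₁ ++ [x], c₂, x, by simp, ?_, hc⟩⟩⟩
      rw [← List.cons_append, List.getLast?_append]; simp
  have hn : ((c ++ [z]).map (edge φ)).Nodup := by
    rw [List.map_append, List.map_singleton, List.nodup_append]
    refine ⟨h3, by simp, ?_⟩
    rintro a ha b hb rfl
    obtain rfl : a = edge φ z := by simpa using hb
    exact hze ha
  have ho : ∀ x ∈ c ++ [z], x ∉ P ∧ φ x ∉ P := by
    intro x hx
    rcases List.mem_append.1 hx with hx | hx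
    · exact h4 x hx
    · obtain rfl : x = z := by simpa using hx
      exact ⟨hzP, hz⟩
  by_cases hzz : φ z = z
  · exact .inl ⟨q, c ++ [z], hq, hc, hn, ho, .inl ⟨c, z, rfl, hzz, h5⟩⟩
  · refine .inr ⟨hz, q, hq, c ++ [z], hc, ?_, hn, ho, ?_⟩
    · rw [← List.cons_append, List.getLast?_append]; simp
    · intro x hx
      rcases List.mem_append.1 hx with hx | hx
      · exact h5 x hx
      · obtain rfl : x = z := by simpa using hx
        exact hzz

/-- The invariant includes `φ z ∉ P`, which is false at `z = φ v`; so a side must have been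
completed on the way. -/
lemma exists_side {P : Set V} {v : V} (hv : v ∈ P) (h : TransGen (Arc G φ) v (φ v)) :
    ∃ q c, Side G φ P q c := by
  have key : ∀ z, TransGen (Arc G φ) v z → (∃ q c, Side G φ P q c) ∨ (φ z ∉ P ∧
      ∃ q ∈ P, ∃ c, (q :: c).IsChain (Arc G φ) ∧ (q :: c).getLast? = some z ∧
      (c.map (edge φ)).Nodup ∧ (∀ x ∈ c, x ∉ P ∧ φ x ∉ P) ∧ ∀ x ∈ c, φ x ≠ x) := by
    intro z hz
    induction hz with
    | single h => exact hφ.exists_side_step ⟨v, hv, [], by simp⟩ h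
    | tail _ h ih =>
      rcases ih with ih | ⟨-, ih⟩
      · exact .inl ih
      · exact hφ.exists_side_step ih h
  rcases key _ h with h | h
  · exact h
  · exact absurd hv (by simpa [hφ.invol] using h.1)

omit hφ in
lemma elementary_singleton {v : V} (hv : φ v ≠ v) : Elementary G φ {v} where
  disj := by simpa using hv
  conn := by
    rintro x rfl y rfl
    exact .refl

lemma Elementary.mirror {P : Set V} (hP : Elementary G φ P) : Elementary G φ {x | φ x ∈ P} where
  disj := by
    intro x hx h
    exact hP.disj _ hx h
  conn := by
    intro x hx y hy
    have := hP.conn (φ y) hy (φ x) hx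
    have key : ∀ a b, a ∈ P → ReflTransGen (fun a b => Arc G φ a b ∧ b ∈ P) a b → b ∈ P ∧
        ReflTransGen (fun a b => Arc G φ a b ∧ b ∈ {x | φ x ∈ P}) (φ b) (φ a) := by
      intro a b ha h
      induction h with
      | refl => exact ⟨ha, .refl⟩
      | tail _ h ih =>
        refine ⟨h.2, .head ⟨hφ.arc_mirror h.1, ?_⟩ ih.2⟩
        simpa [hφ.invol] using ih.1
    have := (key _ _ hy this).2
    rwa [hφ.invol, hφ.invol] at this

/-- Adding an ear: strong connectivity is clear, and distinct matching edges outside `P` exclude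
mirror pairs. -/
lemma Elementary.extend {P : Set V} (hP : Elementary G φ P) {q p : V} {a : List V} (hq : q ∈ P)
    (hp : p ∈ P) (hc : (q :: (a ++ [p])).IsChain (Arc G φ)) (hm : ∀ y ∈ a, φ y ≠ y)
    (hn : (a.map (edge φ)).Nodup) (ho : ∀ y ∈ a, y ∉ P ∧ φ y ∉ P) :
    Elementary G φ (P ∪ {x | x ∈ a}) where
  disj := by
    rintro x (hx | hx) (h | h)
    · exact hP.disj x hx h
    · exact (ho _ h).2 (by rwa [hφ.invol])
    · exact (ho _ hx).2 h
    · exact hm x hx (List.inj_on_of_nodup_map hn h hx (hφ.edge_apply x))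
  conn := by
    set R := fun a' b => Arc G φ a' b ∧ b ∈ P ∪ {x | x ∈ a}
    have hPR : ∀ x ∈ P, ∀ y ∈ P, ReflTransGen R x y := fun x hx y hy =>
      (hP.conn x hx y hy).lift id fun _ _ h => ⟨h.1, .inl h.2⟩
    have hcR : (q :: (a ++ [p])).IsChain R := by
      refine hc.imp_of_mem_tail_imp fun x y _ hy h => ⟨h, ?_⟩
      rw [List.tail_cons, List.mem_append, List.mem_singleton] at hy
      rcases hy with hy | rfl
      · exact .inr hy
      · exact .inl hp
    have hto : ∀ x ∈ P ∪ {x | x ∈ a}, ReflTransGen R q x ∧ ReflTransGen R x q := by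
      rintro x (hx | hx)
      · exact ⟨hPR q hq x hx, hPR x hx q hq⟩
      · obtain ⟨s, t, rfl⟩ := List.append_of_mem (show x ∈ a from hx)
        refine ⟨reflTransGen_of_isChain (l := s) (hcR.infix ⟨[], t ++ [p], by simp⟩),
          (reflTransGen_of_isChain (l := t) (y := p)
            (hcR.infix ⟨q :: s, [], by simp⟩)).trans (hPR p hp q hq)⟩
    exact fun x hx y hy => (hto x hx).2.trans (hto y hy).1

end IsMate

lemma exists_maximal_elementary [Finite V] {φ : Equiv.Perm V} {v : V}
    (hv : φ v ≠ v) : ∃ P, v ∈ P ∧ Elementary G φ P ∧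
      ∀ P', Elementary G φ P' → P ⊆ P' → P' ⊆ P := by
  obtain ⟨P, hP1, hP2⟩ := (Set.toFinite {P | Elementary G φ P}).exists_le_maximal
    (show {v} ∈ {P | Elementary G φ P} from IsMate.elementary_singleton hv)
  exact ⟨P, hP1 rfl, hP2.1, fun P' h h' => hP2.2 h h'⟩

namespace IsMate
variable {φ : Equiv.Perm V} (hφ : IsMate G φ)
include hφ

/-- This is the only use made of the maximality of `P`. -/
lemma not_even_ear {P : Set V} (hP : Elementary G φ P)
    (hmax : ∀ P', Elementary G φ P' → P ⊆ P' → P' ⊆ P) {q p : V} {a : List V} (hq : q ∈ P)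
    (hp : p ∈ P) (ha : a ≠ []) (hc : (q :: (a ++ [p])).IsChain (Arc G φ)) (hm : ∀ y ∈ a, φ y ≠ y)
    (hn : (a.map (edge φ)).Nodup) (ho : ∀ y ∈ a, y ∉ P ∧ φ y ∉ P) : False := by
  obtain ⟨x, hx⟩ := List.exists_mem_of_ne_nil a ha
  exact (ho x hx).1 (hmax _ (Elementary.extend hφ hP hq hp hc hm hn ho) Set.subset_union_left
    (.inr hx))

/-- Walks leaving a maximal elementary set on the two sides are disjoint, or else the first merges
into the other, which then runs on to its end. -/
lemma disjoint_or_merge {P : Set V} (hP : Elementary G φ P)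
    (hmax : ∀ P', Elementary G φ P' → P ⊆ P' → P' ⊆ P) {q t : V} {c d : List V}
    (hc : Side G φ P q c) (hd : Side G φ {x | φ x ∈ P} t d) :
    (∀ y ∈ c, edge φ y ∉ d.map (edge φ)) ∨
    ∃ c₁ d₁ z, (q :: (c₁ ++ [z])).IsChain (Arc G φ) ∧ (t :: (d₁ ++ [z])).IsChain (Arc G φ) ∧
      ((d₁ ++ c₁).map (edge φ)).Nodup ∧ (∀ y ∈ d₁ ++ c₁, φ y ≠ y ∧ y ∉ P ∧ φ y ∉ P) ∧
      (z ∉ P ∧ φ z ∉ P) ∧ edge φ z ∉ (d₁ ++ c₁).map (edge φ) ∧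
      (φ z = z ∨ ∃ s b l, (z :: s).IsChain (Arc G φ) ∧ (∀ y ∈ z :: s, φ y ≠ y) ∧
        ((z :: s).map (edge φ)).Nodup ∧ (z :: s).getLast? = some b ∧ Terminal G φ (z :: s) b l ∧
        (∀ y ∈ z :: s, edge φ y ∉ (d₁ ++ c₁).map (edge φ)) ∧
        (∀ y ∈ (z :: s) ++ l, y ∉ P ∧ φ y ∉ P)) := by
  -- `y` is the first token of `c` whose matching edge is on `d`; `z` below is the token of that
  -- edge on `d`.
  rcases exists_first_mem (fun y => edge φ y ∈ d.map (edge φ)) c with h | ⟨c₁, y, c₂, rfl, h1, h2⟩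
  · exact .inl h
  right
  obtain ⟨z, hz, hzy⟩ := List.mem_map.1 h2
  obtain ⟨d₁, d₂, rfl⟩ := List.append_of_mem hz
  have hdo : ∀ y ∈ d₁ ++ z :: d₂, y ∉ P ∧ φ y ∉ P := by
    intro y hy
    have := hd.outside y hy
    simp only [Set.mem_ofPred_eq, hφ.invol] at this
    exact this.symm
  have hco : ∀ y ∈ c₁, y ∉ P ∧ φ y ∉ P := fun y hy => hc.outside y (by simp [hy])
  have hcm : ∀ y ∈ c₁, φ y ≠ y := by
    rcases hc.close with ⟨r, u, hr, -, hrm⟩ | ⟨h, -⟩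
    · intro x hx
      apply hrm
      rcases List.eq_nil_or_concat c₂ with rfl | ⟨e, w, rfl⟩
      · have := (List.append_inj' hr rfl).1
        rwa [← this]
      · rw [List.concat_eq_append, ← List.cons_append, ← List.append_assoc] at hr
        have := (List.append_inj' hr rfl).1
        rw [← this]; simp [hx]
    · exact fun x hx => h x (by simp [hx])
  have hdm : ∀ y ∈ d₁, φ y ≠ y := by
    rcases hd.close with ⟨r, u, hr, -, hrm⟩ | ⟨h, -⟩
    · intro x hx
      apply hrm
      rcases List.eq_nil_or_concat d₂ with rfl | ⟨e, w, rfl⟩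
      · have := (List.append_inj' hr rfl).1
        rwa [← this]
      · rw [List.concat_eq_append, ← List.cons_append, ← List.append_assoc] at hr
        have := (List.append_inj' hr rfl).1
        rw [← this]; simp [hx]
    · exact fun x hx => h x (by simp [hx])
  have hcn : (c₁.map (edge φ)).Nodup := by
    have := hc.nodup
    rw [List.map_append] at this
    exact this.of_append_left
  have hdn := hd.nodup
  rw [List.map_append, List.map_cons, List.nodup_append, List.nodup_cons] at hdn
  obtain ⟨hdn1, ⟨hdn2, hdn3⟩, hdn4⟩ := hdn
  have hd1z : edge φ z ∉ d₁.map (edge φ) := fun h => hdn4 _ h _ (by simp) rfl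
  have hc1z : edge φ z ∉ c₁.map (edge φ) := by
    intro h
    obtain ⟨x, hx, hxz⟩ := List.mem_map.1 h
    exact h1 x hx (by rw [hxz]; exact List.mem_map_of_mem hz)
  have hcd : ∀ e ∈ c₁.map (edge φ), e ∉ (d₁ ++ z :: d₂).map (edge φ) := by
    intro e he
    obtain ⟨x, hx, rfl⟩ := List.mem_map.1 he
    exact h1 x hx
  have hchd : (t :: (d₁ ++ [z])).IsChain (Arc G φ) := hd.chain.prefix ⟨d₂, by simp⟩
  have hchc : (q :: (c₁ ++ [y])).IsChain (Arc G φ) := hc.chain.prefix ⟨c₂, by simp⟩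
  have hn1 : ((d₁ ++ c₁).map (edge φ)).Nodup := by
    rw [List.map_append, List.nodup_append]
    refine ⟨hdn1, hcn, ?_⟩
    rintro e he _ he' rfl
    exact hcd e he' (by rw [List.map_append, List.mem_append]; exact .inl he)
  have hm1 : ∀ y ∈ d₁ ++ c₁, φ y ≠ y ∧ y ∉ P ∧ φ y ∉ P := by
    intro x hx
    rcases List.mem_append.1 hx with hx | hx
    · exact ⟨hdm x hx, hdo x (by simp [hx])⟩
    · exact ⟨hcm x hx, hco x hx⟩
  have hzn : edge φ z ∉ (d₁ ++ c₁).map (edge φ) := by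
    rw [List.map_append, List.mem_append, not_or]
    exact ⟨hd1z, hc1z⟩
  have hzo := hdo z (by simp)
  by_cases hzz : φ z = z
  · have : y = z := by
      rcases hφ.edge_eq_iff.1 hzy with h | h
      · exact h.symm
      · rw [← hφ.apply_eq_iff, hzz] at h; exact h.symm
    subst this
    exact ⟨c₁, d₁, y, hchc, hchd, hn1, hm1, hzo, hzn, .inl hzz⟩
  -- No route may lead from `y` back to `P` along matching edges of `d`: preceded by `c₁`, which
  -- avoids those edges, it would be an ear.
  have ear : ∀ a p, p ∈ P → (y :: (a ++ [p])).IsChain (Arc G φ) → (∀ x ∈ y :: a, φ x ≠ x) →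
      ((y :: a).map (edge φ)).Nodup → (∀ x ∈ y :: a, edge φ x ∈ (d₁ ++ z :: d₂).map (edge φ)) →
      (∀ x ∈ y :: a, x ∉ P ∧ φ x ∉ P) → False := by
    intro a p hp h1 h2 h3 h4 h5
    refine hφ.not_even_ear hP hmax (a := c₁ ++ y :: a) hc.mem hp (by simp) ?_ ?_ ?_ ?_
    · have := List.isChain_split.2 ⟨(List.cons_append ▸ hchc : ((q :: c₁) ++ [y]).IsChain _), h1⟩
      simpa using this
    · intro x hx
      rcases List.mem_append.1 hx with hx | hx
      exacts [hcm x hx, h2 x hx]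
    · rw [List.map_append, List.nodup_append]
      refine ⟨hcn, h3, ?_⟩
      rintro e he _ he' rfl
      obtain ⟨x, hx, rfl⟩ := List.mem_map.1 he'
      exact hcd _ he (h4 x hx)
    · intro x hx
      rcases List.mem_append.1 hx with hx | hx
      exacts [hco x hx, h5 x hx]
  rcases hφ.edge_eq_iff.1 hzy with rfl | hzy'
  swap
  -- If `c` meets the edge in the direction opposite to `d`, then `d₁` read backwards leads to `φ t
  -- ∈ P`.
  · exfalso
    have hy : y = φ z := by rw [hzy', hφ.invol]
    subst hy
    refine ear (mirror φ d₁) (φ t) hd.mem ?_ ?_ ?_ ?_ ?_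
    · simpa using hφ.isChain_mirror hchd
    · intro x hx
      rcases List.mem_cons.1 hx with rfl | hx
      · rw [hφ.invol]; exact Ne.symm hzz
      · rw [hφ.mem_mirror] at hx
        exact fun h => hdm _ hx (by rw [h, h])
    · rw [List.map_cons, List.nodup_cons, hφ.edge_mem_mirror, hφ.nodup_edge_mirror, hφ.edge_apply]
      exact ⟨hd1z, hdn1⟩
    · intro x hx
      rcases List.mem_cons.1 hx with rfl | hx
      · rw [hφ.edge_apply]; exact List.mem_map_of_mem hz
      · rw [hφ.mem_mirror] at hx
        rw [← hφ.edge_apply]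
        exact List.mem_map_of_mem (by simp [hx])
    · intro x hx
      rcases List.mem_cons.1 hx with rfl | hx
      · rw [hφ.invol]; exact hzo.symm
      · rw [hφ.mem_mirror] at hx
        have := hdo _ (List.mem_append_left _ hx)
        rw [hφ.invol] at this
        exact this.symm
  have hzd2n : ((z :: d₂).map (edge φ)).Nodup := by
    rw [List.map_cons, List.nodup_cons]; exact ⟨hdn2, hdn3⟩
  have hzd2 : ∀ x ∈ z :: d₂, edge φ x ∉ (d₁ ++ c₁).map (edge φ) := by
    intro x hx
    rw [List.map_append, List.mem_append, not_or]
    refine ⟨fun h => hdn4 _ h _ (by simpa using List.mem_map_of_mem (f := edge φ) hx) rfl,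
      fun h => hcd _ h (List.mem_map_of_mem (List.mem_append_right _ hx))⟩
  refine ⟨c₁, d₁, z, hchc, hchd, hn1, hm1, hzo, hzn, .inr ?_⟩
  rcases hd.close with ⟨r, u, hr, hu, hrm⟩ | ⟨hdm', ⟨r, l, x, hr, hx, hch⟩ | ⟨q', hq', -, hch⟩⟩
  · rcases List.eq_nil_or_concat d₂ with rfl | ⟨e, w, rfl⟩
    · have := (List.append_inj' hr rfl).2
      simp only [List.cons.injEq, and_true] at this
      exact absurd (this ▸ hu) hzz
    · rw [List.concat_eq_append] at *
      rw [← List.cons_append, ← List.append_assoc] at hr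
      obtain ⟨rfl, hw⟩ := List.append_inj' hr rfl
      obtain rfl : w = u := by simpa using hw
      obtain ⟨b, hb⟩ : ∃ b, (z :: e).getLast? = some b :=
        ⟨_, List.getLast?_eq_some_getLast (by simp)⟩
      have hch : (z :: (e ++ [w])).IsChain (Arc G φ) := hd.chain.suffix ⟨t :: d₁, by simp⟩
      refine ⟨e, b, [w], hch.prefix ⟨[w], by simp⟩, ?_, ?_, hb, .inl ⟨w, rfl, hu, ?_⟩, ?_, ?_⟩
      · exact fun x hx => hrm x (List.mem_append_right _ hx)
      · rw [← List.cons_append, List.map_append] at hzd2n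
        exact hzd2n.of_append_left
      · rw [← List.cons_append, List.isChain_append] at hch
        exact hch.2.2 b hb w (by simp)
      · exact fun x hx => hzd2 x (by simp at hx ⊢; tauto)
      · exact fun x hx => hdo x (by simp at hx ⊢; tauto)
  -- If the blossom of `d` is based before `z`, then `c` can follow `d₂` round to the base and `r`
  -- backwards to `φ t`.
  · have hblossom : ∀ r e, d₁ = r ++ e → (t :: r).getLast? = some x → False := by
      rintro r e rfl hx
      refine ear (d₂ ++ mirror φ r) (φ t) hd.mem ?_ ?_ ?_ ?_ ?_
      · have h1 : (z :: d₂).IsChain (Arc G φ) := hch.infix ⟨t :: (r ++ e), [φ x], by simp⟩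
        have h2 := hφ.isChain_mirror (hch.infix ⟨[], e ++ z :: d₂ ++ [φ x], by simp⟩ :
          (t :: r).IsChain (Arc G φ))
        rw [List.append_assoc, ← List.cons_append, List.isChain_append]
        refine ⟨h1, by simpa using h2, ?_⟩
        intro a ha b hb
        have hb' : b = φ x := by
          rw [← mirror_cons, mirror, List.head?_reverse, List.getLast?_map, hx] at hb
          simpa using hb.symm
        have h3 : ((z :: d₂) ++ [φ x]).IsChain (Arc G φ) := hch.suffix ⟨t :: (r ++ e), by simp⟩
        rw [List.isChain_append] at h3
        exact h3.2.2 a ha b (by simp [hb'])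
      · intro x hx
        rw [← List.cons_append, List.mem_append, hφ.mem_mirror] at hx
        rcases hx with hx | hx
        · exact hdm' x (List.mem_append_right _ hx)
        · exact fun h => hdm _ (List.mem_append_left _ hx) (by rw [h, h])
      · rw [← List.cons_append, List.map_append, List.nodup_append, hφ.nodup_edge_mirror]
        rw [List.map_append] at hdn1
        refine ⟨hzd2n, hdn1.of_append_left, ?_⟩
        rintro e he _ he' rfl
        rw [hφ.edge_mem_mirror] at he'
        exact hdn4 _ (by rw [List.map_append]; exact List.mem_append_left _ he') _
          (by simpa using he) rfl
      · intro x hx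
        rw [← List.cons_append, List.mem_append, hφ.mem_mirror] at hx
        rcases hx with hx | hx
        · exact List.mem_map_of_mem (List.mem_append_right _ hx)
        · rw [← hφ.edge_apply]
          exact List.mem_map_of_mem (List.mem_append_left _ (List.mem_append_left _ hx))
      · intro x hx
        rw [← List.cons_append, List.mem_append, hφ.mem_mirror] at hx
        rcases hx with hx | hx
        · exact hdo x (List.mem_append_right _ hx)
        · have := hdo _ (List.mem_append_left _ (List.mem_append_left _ hx))
          rw [hφ.invol] at this
          exact this.symm
    rcases List.append_eq_append_iff.1 hr with ⟨e, rfl, he⟩ | ⟨e, h, -⟩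
    · cases e with
      | nil => exact (hblossom d₁ [] (by simp) (by simpa using hx)).elim
      | cons w e =>
        rw [List.cons_append, List.cons.injEq] at he
        obtain ⟨rfl, rfl⟩ := he
        have hb : (z :: e).getLast? = some x := by
          rw [← List.cons_append, List.getLast?_append] at hx
          obtain ⟨b, hb⟩ : ∃ b, (z :: e).getLast? = some b :=
            ⟨_, List.getLast?_eq_some_getLast (by simp)⟩
          rw [hb] at hx ⊢
          simpa using hx
        have hzel := hzd2n
        rw [← List.cons_append, List.map_append, List.nodup_append] at hzel
        refine ⟨e, x, l, hch.infix ⟨t :: d₁, l ++ [φ x], by simp⟩, ?_, hzel.1, hb,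
          .inr ⟨?_, ?_, hzel.2.1, ?_⟩, ?_, ?_⟩
        · exact fun x hx => hdm' x (by simp at hx ⊢; tauto)
        · rw [← List.cons_append, List.isChain_append] at hch
          have h1 : ((z :: e) ++ (l ++ [φ x])).IsChain (Arc G φ) :=
            (List.isChain_append.2 hch).suffix ⟨t :: d₁, by simp⟩
          rw [List.isChain_append] at h1
          rw [List.isChain_cons]
          exact ⟨fun a ha => h1.2.2 x hb a ha, h1.2.1⟩
        · exact fun x hx => hdm' x (by simp [hx])
        · intro x hx h
          exact hzel.2.2 _ h _ (List.mem_map_of_mem hx) rfl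
        · exact fun x hx => hzd2 x (by simp at hx ⊢; tauto)
        · exact fun x hx => hdo x (by simp at hx ⊢; tauto)
    · exact (hblossom r e h hx).elim
  -- As `d` leaves the mirror of `P`, its return point `φ q'` lies in `P`.
  · exfalso
    refine ear d₂ (φ q') hq' (hch.suffix ⟨t :: d₁, by simp⟩) ?_ hzd2n ?_ ?_
    · exact fun x hx => hdm' x (List.mem_append_right _ hx)
    · exact fun x hx => List.mem_map_of_mem (List.mem_append_right _ hx)
    · exact fun x hx => hdo x (List.mem_append_right _ hx)

end IsMate

/-! ### Rotating the matching inside an elementary set -/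

lemma perm_apply_inv (σ : Equiv.Perm V) (x : V) : σ (σ⁻¹ x) = x := σ.apply_symm_apply x

/-- Rotating the matching by a permutation `σ` of `P` which moves vertices along arcs. -/
structure IsRotation (G : SimpleGraph V) (φ σ : Equiv.Perm V) (P : Set V) : Prop where
  off : ∀ x ∉ P, σ x = x
  arc : ∀ x, σ x ≠ x → Arc G φ x (σ x)

namespace IsRotation

variable {φ σ : Equiv.Perm V} {P : Set V} (hσ : IsRotation G φ σ P) (hφ : IsMate G φ)
  (hP : Elementary G φ P)

include hσ

lemma mem_iff {x : V} : σ x ∈ P ↔ x ∈ P := by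
  constructor
  · intro h
    by_contra hx
    rw [hσ.off x hx] at h
    exact hx h
  · intro h
    by_contra hx
    have := σ.injective (hσ.off _ hx)
    exact hx (by rw [this]; exact h)

lemma inv_off {x : V} (hx : x ∉ P) : σ⁻¹ x = x := by
  rw [Equiv.Perm.inv_eq_iff_eq, hσ.off x hx]

include hP

/-- `φ` maps `P` out of `P`, where `σ` is trivial. So conjugation makes each `x` in `P` take over
the partner of `σ x`. -/
lemma apply_mem {x : V} (hx : x ∈ P) : (σ⁻¹ * φ * σ) x = φ (σ x) := by
  rw [Equiv.Perm.mul_apply, Equiv.Perm.mul_apply]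
  exact hσ.inv_off (hP.disj _ (hσ.mem_iff.2 hx))

omit hP in
lemma apply_notMem {x : V} (hx : x ∉ P) (hx' : φ x ∉ P) : (σ⁻¹ * φ * σ) x = φ x := by
  rw [Equiv.Perm.mul_apply, Equiv.Perm.mul_apply, hσ.off x hx]
  exact hσ.inv_off hx'

include hφ

omit hφ in
lemma apply_partner {x : V} (hx : φ x ∈ P) : (σ⁻¹ * φ * σ) x = σ⁻¹ (φ x) := by
  rw [Equiv.Perm.mul_apply, Equiv.Perm.mul_apply, hσ.off x]
  intro h
  exact hP.disj x h hx

lemma isMate : IsMate G (σ⁻¹ * φ * σ) where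
  invol x := by simp [hφ.invol]
  adj x hx := by
    have key : ∀ x ∈ P, G.Adj x (φ (σ x)) := by
      intro x hx
      by_cases h : σ x = x
      · rw [h]
        exact hφ.adj x fun h' => hP.disj x hx (by rwa [h'])
      · exact (hσ.arc x h).1
    by_cases h : x ∈ P
    · rw [hσ.apply_mem hP h]
      exact key x h
    by_cases h' : φ x ∈ P
    · rw [hσ.apply_partner hP h']
      have := key (σ⁻¹ (φ x)) (by rw [← hσ.mem_iff]; simpa using h')
      rw [perm_apply_inv, hφ.invol] at this
      exact this.symm
    · rw [hσ.apply_notMem h h'] at hx ⊢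
      exact hφ.adj x hx

omit hφ in
lemma apply_mem_iff {x : V} : (σ⁻¹ * φ * σ) x ∈ P ↔ φ x ∈ P := by
  by_cases h : x ∈ P
  · rw [hσ.apply_mem hP h]
    exact iff_of_false (hP.disj _ (hσ.mem_iff.2 h)) (hP.disj _ h)
  by_cases h' : φ x ∈ P
  · rw [hσ.apply_partner hP h', ← hσ.mem_iff]
    simp [h']
  · rw [hσ.apply_notMem h h']

/-- The former matching edge at `σ y` now serves as the non-matching edge: rotation reverses its
cycles. -/
lemma arc_back {y : V} (hy : y ∈ P) (h : σ y ≠ y) : Arc G (σ⁻¹ * φ * σ) (σ y) y := by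
  refine ⟨?_, h⟩
  rw [hσ.apply_mem hP hy]
  exact hφ.adj _ fun h' => hP.disj _ (hσ.mem_iff.2 hy) (by rw [h']; exact hσ.mem_iff.2 hy)

-- Old arcs into `σ y` become arcs into `y`, which has inherited the partner.
omit hφ in
lemma arc_shift {x y : V} (hy : y ∈ P) (h : Arc G φ x (σ y)) (hxy : x ≠ y) :
    Arc G (σ⁻¹ * φ * σ) x y := by
  refine ⟨?_, hxy⟩
  rw [hσ.apply_mem hP hy]
  exact h.1

/-- An old arc into `b` now enters `σ⁻¹ b`. The reversed cycles lead from `z` to `σ⁻¹ z`, and finite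
order makes `σ` a power of `σ⁻¹`, so `b` is still reached. -/
lemma elementary [Finite V] : Elementary G (σ⁻¹ * φ * σ) P where
  disj x hx h := hP.disj x hx ((hσ.apply_mem_iff hP).1 h)
  conn := by
    set R := fun a b => Arc G (σ⁻¹ * φ * σ) a b ∧ b ∈ P
    have hinv : ∀ z ∈ P, σ⁻¹ z ∈ P ∧ ReflTransGen R z (σ⁻¹ z) := by
      intro z hz
      have hz' : σ⁻¹ z ∈ P := by rw [← hσ.mem_iff]; simpa using hz
      refine ⟨hz', ?_⟩
      by_cases h : σ (σ⁻¹ z) = σ⁻¹ z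
      · rw [← h]; simpa using .refl
      · have := hσ.arc_back hφ hP hz' h
        rw [perm_apply_inv] at this
        exact .single ⟨this, hz'⟩
    have hpow : ∀ (k : ℕ), ∀ z ∈ P, ReflTransGen R z ((σ⁻¹ ^ k) z) ∧ (σ⁻¹ ^ k) z ∈ P := by
      intro k
      induction k with
      | zero => exact fun z hz => ⟨.refl, hz⟩
      | succ k ih =>
        intro z hz
        rw [pow_succ', Equiv.Perm.mul_apply]
        have h1 := ih z hz
        have h2 := hinv _ h1.2
        exact ⟨h1.1.trans h2.2, h2.1⟩
    have hfwd : ∀ z ∈ P, ReflTransGen R z (σ z) := by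
      intro z hz
      have h1 := (hpow (orderOf σ⁻¹ - 1) z hz).1
      have h2 : (σ⁻¹) ^ (orderOf σ⁻¹ - 1) = σ := by
        have := pow_orderOf_eq_one σ⁻¹
        rw [← Nat.sub_add_cancel (orderOf_pos σ⁻¹), pow_succ] at this
        have := mul_eq_one_iff_eq_inv.1 this
        simpa using this
      rwa [h2] at h1
    intro x hx y hy
    have := hP.conn x hx y hy
    clear hy
    induction this with
    | refl => exact .refl
    | @tail a b _ h ih =>
      refine ih.trans ?_
      obtain ⟨h, hb⟩ := h
      have hb' : σ⁻¹ b ∈ P := (hinv b hb).1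
      have h3 := hfwd _ hb'
      rw [perm_apply_inv] at h3
      by_cases hab : a = σ⁻¹ b
      · rwa [hab]
      · exact .head ⟨hσ.arc_shift hP hb' (by simpa using h) hab, hb'⟩ h3

end IsRotation

lemma isChain_formPerm {α : Type*} [DecidableEq α] {x : α} {l : List α} (h : (x :: l).Nodup) :
    (x :: (l ++ [x])).IsChain (fun a b => (x :: l).formPerm a = b) := by
  rw [← List.cons_append, List.isChain_iff_getElem]
  intro i hi
  simp only [List.length_append, List.length_singleton, Nat.add_lt_add_iff_right] at hi
  rw [List.getElem_append_left hi, List.formPerm_apply_getElem _ h]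
  by_cases hi' : i + 1 < (x :: l).length
  · rw [List.getElem_append_left hi']
    simp only [Nat.mod_eq_of_lt hi']
  · have : i + 1 = (x :: l).length := by omega
    simp [this]

lemma exists_eq_of_not_nodup {α : Type*} {l : List α} (h : ¬ l.Nodup) :
    ∃ S x T U, l = S ++ x :: (T ++ x :: U) := by
  induction l with
  | nil => simp at h
  | cons a l ih =>
    rw [List.nodup_cons, not_and_or, not_not] at h
    rcases h with h | h
    · obtain ⟨T, U, rfl⟩ := List.append_of_mem h
      exact ⟨[], a, T, U, rfl⟩
    · obtain ⟨S, x, T, U, rfl⟩ := ih h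
      exact ⟨a :: S, x, T, U, rfl⟩

lemma isChain_cut {α : Type*} {R : α → α → Prop} {S T U : List α} {x : α}
    (h : (S ++ x :: (T ++ x :: U)).IsChain R) : (S ++ x :: U).IsChain R :=
  List.isChain_split.2 ⟨h.prefix ⟨T ++ x :: U, by simp⟩, h.suffix ⟨S ++ x :: T, by simp⟩⟩

/-! ### A path through a prescribed vertex -/

/-- Any two vertices of an elementary set are joined, after a rotation of the matching, by a path
through any given third one. -/
lemma exists_path_through [Finite V] {P : Set V} {v t q : V} (n : ℕ) :
    ∀ {φ : Equiv.Perm V}, IsMaxMate G φ → Elementary G φ P → ∀ {A B : List V},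
    A.length + B.length ≤ n → (A ++ v :: B).IsChain (Arc G φ) → (∀ x ∈ A ++ v :: B, x ∈ P) →
    (∃ p, (A ++ v :: B).head? = some p ∧ φ p = t) → (v :: B).getLast? = some q →
    ∃ ψ, IsMaxMate G ψ ∧ Elementary G ψ P ∧ (∀ x, x ∉ P → φ x ∉ P → ψ x = φ x) ∧
      (∀ x, ψ x ∈ P ↔ φ x ∈ P) ∧
      ∃ L : List V, L.IsChain (Arc G ψ) ∧ L.Nodup ∧ (∀ x ∈ L, x ∈ P) ∧
        (∃ p, L.head? = some p ∧ ψ p = t) ∧ L.getLast? = some q ∧ v ∈ L := by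
  classical
  -- Shorten a walk through `v`. A repetition on one side of `v` is cut out; one across `v` cannot
  -- be, as the cut would lose `v`, and is removed by a rotation.
  induction n using Nat.strong_induction_on with
  | _ n ih =>
  intro φ hφ hP A B hn hc hmem hp hq
  by_cases hnd : (A ++ v :: B).Nodup
  · refine ⟨φ, hφ, hP, fun _ _ _ => rfl, fun _ => Iff.rfl, A ++ v :: B, hc, hnd, hmem, hp, ?_,
      by simp⟩
    rw [List.getLast?_append, hq]; rfl
  by_cases hA : (A ++ [v]).Nodup
  swap
  · obtain ⟨S, x, T, U, h⟩ := exists_eq_of_not_nodup hA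
    have hfull : A ++ v :: B = S ++ x :: (T ++ x :: (U ++ B)) := by
      have := congrArg (· ++ B) h
      simpa using this
    have hc' : (S ++ x :: (U ++ B)).IsChain (Arc G φ) := isChain_cut (hfull ▸ hc)
    have hp' : ∃ p, (S ++ x :: (U ++ B)).head? = some p ∧ φ p = t := by
      rw [hfull] at hp
      simpa [List.head?_append] using hp
    have hmem' : ∀ y ∈ S ++ x :: (U ++ B), y ∈ P := by
      intro y hy
      apply hmem
      rw [hfull]
      simp at hy ⊢; tauto
    rcases List.eq_nil_or_concat U with rfl | ⟨U, w, rfl⟩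
    · obtain ⟨rfl, hx⟩ := List.append_inj' (h.trans (by simp : _ = (S ++ x :: T) ++ [x])) rfl
      obtain rfl : v = x := by simpa using hx
      refine ih (S.length + B.length) ?_ hφ hP (A := S) (B := B) le_rfl (by simpa using hc')
        (by simpa using hmem') (by simpa using hp') hq
      simp at hn; omega
    · rw [List.concat_eq_append] at *
      obtain ⟨rfl, hw⟩ := List.append_inj'
        (h.trans (by simp : _ = (S ++ x :: (T ++ x :: U)) ++ [w])) rfl
      obtain rfl : v = w := by simpa using hw
      refine ih ((S ++ x :: U).length + B.length) ?_ hφ hP (A := S ++ x :: U) (B := B) le_rfl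
        (by simpa using hc') (by simpa using hmem') (by simpa using hp') hq
      simp at hn ⊢; omega
  by_cases hB : (v :: B).Nodup
  swap
  · obtain ⟨S, x, T, U, h⟩ := exists_eq_of_not_nodup hB
    have hc' : (A ++ (S ++ x :: U)).IsChain (Arc G φ) := by
      rw [h, ← List.append_assoc] at hc
      rw [← List.append_assoc]
      exact isChain_cut hc
    have hp' : ∃ p, (A ++ (S ++ x :: U)).head? = some p ∧ φ p = t := by
      rw [h] at hp
      simpa [List.head?_append] using hp
    have hmem' : ∀ y ∈ A ++ (S ++ x :: U), y ∈ P := by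
      intro y hy
      apply hmem
      rw [h]
      simp at hy ⊢; tauto
    have hq' : (S ++ x :: U).getLast? = some q := by
      rw [h] at hq
      simpa [List.getLast?_append, List.getLast?_cons] using hq
    cases S with
    | nil =>
      rw [List.nil_append, List.cons.injEq] at h
      obtain ⟨rfl, rfl⟩ := h
      refine ih (A.length + U.length) ?_ hφ hP (A := A) (B := U) le_rfl hc' hmem' hp' hq'
      simp at hn; omega
    | cons w S =>
      rw [List.cons_append, List.cons.injEq] at h
      obtain ⟨rfl, rfl⟩ := h
      refine ih (A.length + (S ++ x :: U).length) ?_ hφ hP (A := A) (B := S ++ x :: U) le_rfl hc'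
        hmem' hp' hq'
      simp at hn ⊢; omega
  -- `x` is the first vertex after `v` that also occurs before it, so `x`, `A₂`, `v`, `B₁` form a
  -- directed cycle.
  rcases exists_first_mem (· ∈ A) B with h | ⟨B₁, x, C, rfl, hB₁, hx⟩
  · exfalso
    apply hnd
    rw [List.nodup_append] at hA ⊢
    refine ⟨hA.1, hB, ?_⟩
    rintro a ha b hb rfl
    rcases List.mem_cons.1 hb with rfl | hb
    · exact hA.2.2 a ha a (by simp) rfl
    · exact h a hb ha
  obtain ⟨A₁, A₂, rfl⟩ := List.append_of_mem hx
  set l := A₂ ++ v :: B₁ with hl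
  have hfull : A₁ ++ x :: A₂ ++ v :: (B₁ ++ x :: C) = A₁ ++ (x :: (l ++ [x])) ++ C := by simp [hl]
  have hcyc : (x :: (l ++ [x])).IsChain (Arc G φ) := by
    rw [hfull] at hc
    exact hc.infix ⟨A₁, C, rfl⟩
  have hnA := hA
  have hnB := hB
  have hA₁ : ∀ a ∈ A₁, a ∉ x :: l := by
    intro a ha hal
    simp only [hl, List.mem_cons, List.mem_append] at hal
    simp only [List.nodup_append, List.mem_append, List.mem_cons] at hnA
    rcases hal with rfl | h | rfl | h
    · exact hnA.1.2.2 a ha a (.inl rfl) rfl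
    · exact hnA.1.2.2 a ha a (.inr h) rfl
    · exact hnA.2.2 a (.inl ha) a (.inl rfl) rfl
    · exact hB₁ a h (by simp [ha])
  have hlnd : (x :: l).Nodup := by
    have h1 : ((x :: A₂) ++ [v]).Nodup := by
      have : ((A₁ ++ x :: A₂) ++ [v]) = A₁ ++ ((x :: A₂) ++ [v]) := by simp
      rw [this] at hnA
      exact hnA.of_append_right
    rw [hl, ← List.cons_append, List.nodup_append]
    rw [List.nodup_append] at h1
    have h2 : (v :: B₁).Nodup := by
      rw [← List.cons_append] at hnB
      exact hnB.of_append_left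
    refine ⟨h1.1, h2, ?_⟩
    rintro a ha b hb rfl
    rcases List.mem_cons.1 hb with rfl | hb
    · exact h1.2.2 a ha a (by simp) rfl
    · exact hB₁ a hb (by simp at ha ⊢; tauto)
  set σ := (x :: l).formPerm with hσdef
  have hlP : ∀ y ∈ x :: l, y ∈ P := by
    intro y hy
    apply hmem
    rw [hfull]
    simp at hy ⊢; tauto
  have hσoff : ∀ y, y ∉ x :: l → σ y = y := fun y hy => List.formPerm_apply_of_notMem hy
  have hσch : ((x :: l) ++ [x]).IsChain (fun a b => σ a = b) := isChain_formPerm hlnd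
  have hσ : IsRotation G φ σ P := by
    refine ⟨fun y hy => hσoff y fun h => hy (hlP y h), fun y hy => ?_⟩
    have hyl : y ∈ x :: l := by
      by_contra h
      exact hy (hσoff y h)
    obtain ⟨S, T, hST⟩ := List.append_of_mem hyl
    have hST' : x :: (l ++ [x]) = S ++ y :: (T ++ [x]) := by
      rw [← List.cons_append, hST]; simp
    rw [hST'] at hcyc
    rw [List.cons_append, hST'] at hσch
    obtain ⟨z, U, hz⟩ : ∃ z U, T ++ [x] = z :: U := by
      cases T with
      | nil => exact ⟨x, [], rfl⟩
      | cons z U => exact ⟨z, U ++ [x], rfl⟩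
    rw [hz] at hcyc hσch
    have h1 := (List.isChain_append_cons_cons.1 hcyc).2.1
    have h2 := (List.isChain_append_cons_cons.1 hσch).2.1
    rwa [h2]
  set ψ := σ⁻¹ * φ * σ with hψ
  have hψm : IsMaxMate G ψ := hφ.conj (hσ.isMate hφ.1 hP)
  have hψP : Elementary G ψ P := hσ.elementary hφ.1 hP
  have hψoff : ∀ y ∈ P, y ∉ x :: l → ψ y = φ y := by
    intro y hy hyl
    rw [hψ, hσ.apply_mem hP hy, hσoff y hyl]
  have hrev : (x :: l).reverse.IsChain (Arc G ψ) := by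
    rw [List.isChain_reverse]
    have h1 : (x :: l).IsChain (fun a b => σ a = b) := hσch.prefix ⟨[x], by simp⟩
    have h2 : (x :: l).IsChain (fun a b => a ≠ b) := by
      have := hlnd
      exact List.Pairwise.isChain this
    have h3 := List.isChain_iff_forall_rel_of_append_cons_cons.1 h1
    have h4 := List.isChain_iff_forall_rel_of_append_cons_cons.1 h2
    rw [List.isChain_iff_forall_rel_of_append_cons_cons]
    intro a b l₁ l₂ h
    have h5 := h3 h
    have h6 := h4 h
    have := hσ.arc_back hφ.1 hP (y := a) (hlP a (by rw [h]; simp)) (by rw [h5]; exact h6.symm)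
    rwa [h5] at this
  -- `w` is the last vertex of the walk on the cycle. It lies in `x :: A₂` because `v :: B` has no
  -- repetition.
  obtain ⟨C₁, w, C₂, hw, hwl, hC₂⟩ : ∃ C₁ w C₂, x :: C = C₁ ++ w :: C₂ ∧ w ∈ x :: l ∧
      ∀ y ∈ C₂, y ∉ x :: l := by
    rcases exists_first_mem (· ∈ x :: l) (x :: C).reverse with h | ⟨l₁, w, l₂, h, h1, h2⟩
    · exact absurd (List.mem_cons_self) (h x (by simp))
    · refine ⟨l₂.reverse, w, l₁.reverse, ?_, h2, by simpa using h1⟩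
      have := congrArg List.reverse h
      simpa using this
  have hwA : w ∈ x :: A₂ := by
    have hwC : w ∈ x :: C := by rw [hw]; simp
    have : (v :: B₁ ++ x :: C).Nodup := hnB
    rw [List.nodup_append] at this
    rw [hl, ← List.cons_append, List.mem_append] at hwl
    rcases hwl with h | h
    · exact h
    · exact absurd rfl (this.2.2 w h w hwC)
  obtain ⟨A₃, A₄, hA₄⟩ := List.append_of_mem hwA
  have hlen1 : A₄.length ≤ A₂.length := by
    have := congrArg List.length hA₄
    simp at this; omega
  have hlen2 : C₂.length ≤ C.length := by
    have := congrArg List.length hw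
    simp at this; omega
  have hcoff : ∀ {D : List V}, (∀ y ∈ D.tail, y ∈ P ∧ y ∉ x :: l) → D.IsChain (Arc G φ) →
      D.IsChain (Arc G ψ) := by
    intro D hD h
    refine h.imp_of_mem_tail_imp fun a b _ hb hab => ⟨?_, hab.2⟩
    rw [hψoff b (hD b hb).1 (hD b hb).2]
    exact hab.1
  have hnew1 : (B₁.reverse ++ v :: (A₄.reverse ++ [w])).IsChain (Arc G ψ) := by
    refine hrev.prefix ⟨A₃.reverse, ?_⟩
    have : x :: l = A₃ ++ w :: A₄ ++ v :: B₁ := by rw [← hA₄, hl]; simp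
    rw [this]; simp
  have hnew2 : (w :: C₂).IsChain (Arc G ψ) := by
    apply hcoff
    · intro y hy
      refine ⟨hmem y ?_, hC₂ y hy⟩
      have : y ∈ x :: C := by rw [hw]; simp at hy ⊢; tauto
      simp at this ⊢; tauto
    · have : A₁ ++ x :: A₂ ++ v :: (B₁ ++ x :: C) =
          A₁ ++ x :: A₂ ++ v :: B₁ ++ C₁ ++ (w :: C₂) := by rw [hw]; simp
      rw [this] at hc
      exact hc.right_of_append
  have hnew3 : (B₁.reverse ++ v :: (A₄.reverse ++ w :: C₂)).IsChain (Arc G ψ) := by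
    have := List.isChain_split.2
      ⟨(by simpa using hnew1 : ((B₁.reverse ++ v :: A₄.reverse) ++ [w]).IsChain _), hnew2⟩
    simpa using this
  -- `h` is the predecessor of `x` on the cycle. As `σ h = x`, it inherits the partner of `x`, so
  -- the walk now enters the cycle (or starts) at `h`.
  obtain ⟨h, D, hhD, hh⟩ : ∃ h D, B₁.reverse ++ v :: (A₄.reverse ++ w :: C₂) = h :: D ∧
      (x :: l).getLast? = some h := by
    rcases List.eq_nil_or_concat B₁ with rfl | ⟨B₂, h, rfl⟩
    · exact ⟨v, _, rfl, by simp [hl, List.getLast?_cons]⟩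
    · exact ⟨h, _, by simp; rfl, by simp [hl, List.getLast?_cons]⟩
  have hhl : h ∈ x :: l := List.mem_of_getLast? hh
  have hσh : σ h = x := by
    rw [List.isChain_append] at hσch
    exact hσch.2.2 h hh x (by simp)
  have hnew : (A₁ ++ (B₁.reverse ++ v :: (A₄.reverse ++ w :: C₂))).IsChain (Arc G ψ) := by
    rw [List.isChain_append]
    have hc' : (A₁ ++ x :: (l ++ [x] ++ C)).IsChain (Arc G φ) := by
      rw [hfull] at hc; simpa using hc
    refine ⟨hcoff (fun y hy => ?_) hc'.left_of_append, hnew3, ?_⟩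
    · have := List.mem_of_mem_tail hy
      exact ⟨hmem y (by simp [this]), hA₁ y this⟩
    · intro a ha b hb
      rw [hhD] at hb
      obtain rfl : h = b := by simpa using hb
      rw [List.isChain_append] at hc'
      refine hσ.arc_shift hP (hlP h hhl) ?_ ?_
      · rw [hσh]; exact hc'.2.2 a ha x (by simp)
      · rintro rfl
        exact hA₁ a (List.mem_of_getLast? ha) hhl
  -- The new walk follows the reversed cycle from `h` through `v` to `w` and continues with `C₂`; it
  -- is shorter by at least one vertex.
  obtain ⟨ψ', h1, h2, h3, h4, h5⟩ := ih
    ((A₁ ++ B₁.reverse).length + (A₄.reverse ++ w :: C₂).length)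
    (by simp at hn ⊢; omega) hψm hψP (A := A₁ ++ B₁.reverse) (B := A₄.reverse ++ w :: C₂) le_rfl
    (by simpa using hnew) (by
      intro y hy
      apply hmem
      rcases List.mem_append.1 hy with hy | hy
      · rcases List.mem_append.1 hy with hy | hy
        · exact List.mem_append_left _ (List.mem_append_left _ hy)
        · exact List.mem_append_right _ (List.mem_cons_of_mem _
            (List.mem_append_left _ (List.mem_reverse.1 hy)))
      rcases List.mem_cons.1 hy with hy | hy
      · rw [hy]; exact List.mem_append_right _ List.mem_cons_self
      rcases List.mem_append.1 hy with hy | hy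
      · refine List.mem_append_left _ (List.mem_append_right _ ?_)
        rw [hA₄]
        exact List.mem_append_right _ (List.mem_cons_of_mem _ (List.mem_reverse.1 hy))
      · refine List.mem_append_right _ (List.mem_cons_of_mem _ (List.mem_append_right _ ?_))
        rw [hw]
        exact List.mem_append_right _ hy) (by
      obtain ⟨p, hp, hpt⟩ := hp
      cases A₁ with
      | nil =>
        obtain rfl : x = p := by simpa using hp
        refine ⟨h, ?_, ?_⟩
        · rw [List.nil_append, hhD]; rfl
        · rw [hψ, hσ.apply_mem hP (hlP h hhl), hσh, hpt]
      | cons a A₁ =>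
        obtain rfl : a = p := by simpa using hp
        refine ⟨a, by simp, ?_⟩
        rw [hψoff a (hmem a (by simp)) (hA₁ a (by simp)), hpt]) (by
      have h1 : (v :: (B₁ ++ x :: C)).getLast? = (x :: C).getLast? := by
        rw [← List.cons_append, List.getLast?_append]
        simp [List.getLast?_cons]
      rw [h1, hw] at hq
      simpa [List.getLast?_append, List.getLast?_cons] using hq)
  refine ⟨ψ', h1, h2, fun y hy hy' => ?_, fun y => (h4 y).trans (hσ.apply_mem_iff hP), h5⟩
  have h6 : ψ y = φ y := hσ.apply_notMem hy hy'
  rw [h3 y hy (by rwa [h6]), h6]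

/-- A path in `P` from the list `S` to a reachable vertex, leaving `S` at once. -/
lemma exists_exit_path {α : Type*} {R : α → α → Prop} {P : Set α} {S : List α} {a b : α}
    (ha : a ∈ S) (h : ReflTransGen (fun x y => R x y ∧ y ∈ P) a b) :
    ∃ x ∈ S, ∃ l, (x :: l).IsChain R ∧ l.Nodup ∧ (∀ y ∈ l, y ∈ P ∧ y ∉ S) ∧
      (x :: l).getLast? = some b := by
  induction h with
  | refl => exact ⟨a, ha, [], by simp⟩
  | @tail b c _ h ih =>
    obtain ⟨x, hx, l, h1, h2, h3, h4⟩ := ih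
    by_cases hcS : c ∈ S
    · exact ⟨c, hcS, [], by simp⟩
    by_cases hcl : c ∈ l
    · obtain ⟨l₁, l₂, rfl⟩ := List.append_of_mem hcl
      refine ⟨x, hx, l₁ ++ [c], h1.prefix ⟨l₂, by simp⟩, ?_, ?_, ?_⟩
      · rw [List.append_cons] at h2
        exact h2.of_append_left
      · exact fun y hy => h3 y (by simp at hy ⊢; tauto)
      · rw [← List.cons_append, List.getLast?_append]; simp
    · refine ⟨x, hx, l ++ [c], ?_, ?_, ?_, ?_⟩
      · rw [← List.cons_append, List.isChain_append]
        refine ⟨h1, by simp, ?_⟩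
        intro y hy z hz
        obtain rfl : b = y := Option.mem_unique h4 hy
        obtain rfl : c = z := by simpa using hz
        exact h.1
      · rw [List.nodup_append]
        refine ⟨h2, by simp, ?_⟩
        rintro y hy z hz rfl
        obtain rfl : y = c := by simpa using hz
        exact hcl hy
      · intro y hy
        rcases List.mem_append.1 hy with hy | hy
        · exact h3 y hy
        · obtain rfl : y = c := by simpa using hy
          exact ⟨h.2, hcS⟩
      · rw [← List.cons_append, List.getLast?_append]; simp

lemma eq_concat_of_getLast? {α : Type*} {l : List α} {a : α} (h : l.getLast? = some a) :
    ∃ l', l = l' ++ [a] := by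
  rcases List.eq_nil_or_concat l with rfl | ⟨l', b, rfl⟩
  · simp at h
  · rw [List.concat_eq_append, List.getLast?_append] at h
    exact ⟨l', by simpa using h⟩

/-! ### Continuing a path in an elementary set along a side -/

namespace IsMate

variable {φ : Equiv.Perm V} (hφ : IsMate G φ)
include hφ

lemma edge_ne_of_outside {P : Set V} {x y : V} (hx : x ∈ P) (hy : y ∉ P ∧ φ y ∉ P) :
    edge φ x ≠ edge φ y := by
  rw [Ne, hφ.edge_eq_iff]
  rintro (rfl | rfl)
  exacts [hy.1 hx, hy.2 hx]

lemma edge_injOn {P : Set V} (hP : ∀ x ∈ P, φ x ∉ P) {x y : V} (hx : x ∈ P) (hy : y ∈ P)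
    (h : edge φ x = edge φ y) : x = y := by
  rcases hφ.edge_eq_iff.1 h with h | rfl
  · exact h
  · exact absurd hx (hP y hy)

lemma nodup_map_edge {P : Set V} (hP : ∀ x ∈ P, φ x ∉ P) {l : List V} (hl : l.Nodup)
    (hlP : ∀ x ∈ l, x ∈ P) : (l.map (edge φ)).Nodup :=
  hl.map_on fun x hx y hy h => hφ.edge_injOn hP (hlP x hx) (hlP y hy) h

/-- A path in an elementary set, followed by a walk leaving that set, ends in an unmatched vertex or
a blossom. -/
lemma exists_terminal {P : Set V} (hP : Elementary G φ P) {L c : List V} {q : V}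
    (hL : L.IsChain (Arc G φ)) (hLn : L.Nodup) (hLP : ∀ x ∈ L, x ∈ P)
    (hq : L.getLast? = some q) (hc : Side G φ P q c) :
    ∃ L₁ L₂ r b l, L = L₁ ++ L₂ ∧ L₁ ≠ [] ∧ (L₁ ++ r).IsChain (Arc G φ) ∧
      (L₁ ++ r).getLast? = some b ∧ (∀ y ∈ r, y ∈ c ∧ φ y ≠ y) ∧ (r.map (edge φ)).Nodup ∧
      Terminal G φ (L₁ ++ r) b l ∧ (∀ y ∈ l, (y ∈ P ∨ φ y ∈ P) ∨ y ∈ c) ∧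
      (∀ y ∈ l, edge φ y ∉ (L₁ ++ r).map (edge φ)) ∧
      ∀ z ∈ L₂, edge φ z ∈ l.map (edge φ) := by
  have hstem : ∀ {r l b}, c = r ++ l → (q :: r).getLast? = some b →
      (L ++ r).IsChain (Arc G φ) ∧ (L ++ r).getLast? = some b ∧ (r.map (edge φ)).Nodup ∧
      (l.map (edge φ)).Nodup ∧ ∀ y ∈ l, edge φ y ∉ (L ++ r).map (edge φ) := by
    rintro r l b rfl hb
    obtain ⟨L₀, rfl⟩ := eq_concat_of_getLast? hq
    have hn := hc.nodup
    rw [List.map_append, List.nodup_append] at hn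
    refine ⟨?_, ?_, hn.1, hn.2.1, ?_⟩
    · have := List.isChain_split.2
        ⟨hL, (hc.chain.prefix ⟨l, by simp⟩ : (q :: r).IsChain (Arc G φ))⟩
      simpa using this
    · rw [List.append_assoc, List.singleton_append, List.getLast?_append, hb]; rfl
    · intro y hy h
      rw [List.map_append, List.mem_append] at h
      rcases h with h | h
      · obtain ⟨x, hx, hxy⟩ := List.mem_map.1 h
        exact hφ.edge_ne_of_outside (hLP x hx) (hc.outside y (by simp [hy])) hxy
      · exact hn.2.2 _ h _ (List.mem_map_of_mem hy) rfl
  have hL0 : L ≠ [] := by rintro rfl; simp at hq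
  rcases hc.close with ⟨r, u, hr, hu, hrm⟩ | ⟨hm, ⟨r, l, x, hr, hx, hch⟩ | ⟨q', hq', hne, hch⟩⟩
  · obtain ⟨b, hb⟩ : ∃ b, (q :: r).getLast? = some b :=
      ⟨_, List.getLast?_eq_some_getLast (by simp)⟩
    obtain ⟨h1, h2, h3, h4, h5⟩ := hstem hr hb
    refine ⟨L, [], r, b, [u], by simp, hL0, h1, h2, fun y hy => ⟨by simp [hr, hy], hrm y hy⟩, h3,
      .inl ⟨u, rfl, hu, ?_⟩, fun y hy => .inr (by rw [hr]; simp at hy ⊢; tauto), h5, by simp⟩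
    have := hc.chain
    rw [hr, ← List.cons_append, List.isChain_append] at this
    exact this.2.2 b hb u (by simp)
  · obtain ⟨h1, h2, h3, h4, h5⟩ := hstem hr hx
    subst hr
    refine ⟨L, [], r, x, l, by simp, hL0, h1, h2, fun y hy => ⟨by simp [hy], hm y (by simp [hy])⟩,
      h3, .inr ⟨?_, fun y hy => hm y (by simp [hy]), h4, h5⟩, fun y hy => .inr (by simp [hy]), h5,
      by simp⟩
    obtain ⟨s, hs⟩ := eq_concat_of_getLast? hx
    refine hch.suffix ⟨s, ?_⟩
    have : q :: (r ++ l ++ [φ x]) = (q :: r) ++ (l ++ [φ x]) := by simp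
    rw [this, hs]; simp
  -- The side returns at `φ q'`. A path `R` inside `P` leads to `q'`, leaving `L` for good at `x`.
  -- The rest `U` of `L`, then `c`, then `R` backwards form a blossom based at `x`. Thus `U` is cut
  -- off the stem but stays covered by the blossom.
  · obtain ⟨x, hx, R, hR1, hR2, hR3, hR4⟩ := exists_exit_path (List.mem_of_getLast? hq)
      (hP.conn q hc.mem q' hq')
    obtain ⟨S, U, rfl⟩ := List.append_of_mem hx
    have hUP : ∀ y ∈ U, y ∈ P := fun y hy => hLP y (by simp [hy])
    have hmP : ∀ y ∈ P, φ y ≠ y := fun y hy h => hP.disj y hy (by rwa [h])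
    have hnU : (x :: U).Nodup := hLn.of_append_right
    have hSxU := hLn
    rw [List.append_cons, List.nodup_append] at hSxU
    have hoff : ∀ y ∈ U ++ c ++ mirror φ R, edge φ y ∉ (S ++ [x]).map (edge φ) := by
      intro y hy h
      obtain ⟨w, hw, hwy⟩ := List.mem_map.1 h
      have hwP : w ∈ P := hLP w (by simp at hw ⊢; tauto)
      rw [List.mem_append, List.mem_append, hφ.mem_mirror] at hy
      rcases hy with (hy | hy) | hy
      · exact hSxU.2.2 w hw y hy (hφ.edge_injOn hP.disj hwP (hUP y hy) hwy)
      · exact hφ.edge_ne_of_outside hwP (hc.outside y hy) hwy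
      · rw [← hφ.edge_apply y] at hwy
        have := hφ.edge_injOn hP.disj hwP (hR3 _ hy).1 hwy
        exact (hR3 _ hy).2 (by rw [← this]; simp at hw ⊢; tauto)
    refine ⟨S ++ [x], U, [], x, U ++ c ++ mirror φ R, by simp, by simp, ?_, by simp, by simp,
      by simp, .inr ⟨?_, ?_, ?_, by simpa using hoff⟩, ?_, by simpa using hoff, ?_⟩
    · rw [List.append_nil]
      exact hL.prefix ⟨U, by simp⟩
    · have hqU : (x :: U).getLast? = some q := by
        simpa [List.getLast?_append, List.getLast?_cons] using hq
      obtain ⟨s, hs⟩ := eq_concat_of_getLast? hqU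
      obtain ⟨R₀, hR₀⟩ := eq_concat_of_getLast? hR4
      have h1 : (s ++ [q]).IsChain (Arc G φ) := hs ▸ hL.right_of_append
      have h2 := List.isChain_split.2 ⟨h1, hch⟩
      have h3 := hφ.isChain_mirror hR1
      rw [hR₀, mirror_append] at h3
      have h4 : (s ++ q :: c ++ φ q' :: mirror φ R₀).IsChain (Arc G φ) :=
        List.isChain_split.2 ⟨by simpa using h2, by simpa using h3⟩
      have h5 : mirror φ R ++ [φ x] = φ q' :: mirror φ R₀ := by
        rw [← mirror_cons, hR₀]; simp
      have h6 : x :: (U ++ c ++ mirror φ R ++ [φ x]) = s ++ q :: c ++ φ q' :: mirror φ R₀ := by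
        rw [List.append_assoc, h5, ← List.cons_append, ← List.cons_append, hs]; simp
      rwa [h6]
    · intro y hy
      rw [List.mem_append, List.mem_append, hφ.mem_mirror] at hy
      rcases hy with (hy | hy) | hy
      · exact hmP y (hUP y hy)
      · exact hm y hy
      · exact fun h => hmP _ (hR3 _ hy).1 (by rw [h, h])
    · rw [List.map_append, List.map_append, List.nodup_append, List.nodup_append,
        hφ.nodup_edge_mirror]
      refine ⟨⟨hφ.nodup_map_edge hP.disj hnU.of_cons hUP, hc.nodup, ?_⟩,
        hφ.nodup_map_edge hP.disj hR2 fun y hy => (hR3 y hy).1, ?_⟩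
      · rintro e he _ he' rfl
        obtain ⟨y, hy, rfl⟩ := List.mem_map.1 he
        obtain ⟨w, hw, hwy⟩ := List.mem_map.1 he'
        exact hφ.edge_ne_of_outside (hUP y hy) (hc.outside w hw) hwy.symm
      · rintro e he _ he' rfl
        rw [hφ.edge_mem_mirror] at he'
        obtain ⟨y, hy, rfl⟩ := List.mem_map.1 he'
        rw [List.mem_append] at he
        rcases he with he | he
        · obtain ⟨w, hw, hwy⟩ := List.mem_map.1 he
          have := hφ.edge_injOn hP.disj (hUP w hw) (hR3 y hy).1 hwy
          exact (hR3 y hy).2 (by rw [← this]; simp [hw])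
        · obtain ⟨w, hw, hwy⟩ := List.mem_map.1 he
          exact hφ.edge_ne_of_outside (hR3 y hy).1 (hc.outside w hw) hwy.symm
    · intro y hy
      rw [List.mem_append, List.mem_append, hφ.mem_mirror] at hy
      rcases hy with (hy | hy) | hy
      · exact .inl (.inl (hUP y hy))
      · exact .inr hy
      · exact .inl (.inr (hR3 _ hy).1)
    · intro z hz
      exact List.mem_map_of_mem (by simp [hz])

end IsMate

/-! ### Transfer to the rotated matching and final assembly -/

lemma Terminal.mono {φ : Equiv.Perm V} {T T' l : List V} {b : V} (h : Terminal G φ T b l)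
    (h' : ∀ y ∈ l, edge φ y ∉ T'.map (edge φ)) : Terminal G φ T' b l := by
  rcases h with h | ⟨h1, h2, h3, -⟩
  · exact .inl h
  · exact .inr ⟨h1, h2, h3, h'⟩

lemma isChain_congr {φ ψ : Equiv.Perm V} {l : List V} (h : l.IsChain (Arc G φ))
    (hl : ∀ y ∈ l.tail, ψ y = φ y) : l.IsChain (Arc G ψ) :=
  h.imp_of_mem_tail_imp fun x y _ hy hxy => ⟨by rw [hl y hy]; exact hxy.1, hxy.2⟩

lemma map_edge_congr {φ ψ : Equiv.Perm V} {l : List V} (hl : ∀ y ∈ l, ψ y = φ y) :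
    l.map (edge ψ) = l.map (edge φ) :=
  List.map_congr_left fun y hy => by rw [edge, edge, hl y hy]

/-- A side uses only matching edges outside `P` and `φ P`, which are unchanged. The non-matching
edge of a closing arc into `φ x` ends at `x`, whatever the partner of `x` is. -/
lemma Side.congr {φ ψ : Equiv.Perm V} {P : Set V} {q : V} {c : List V} (hc : Side G φ P q c)
    (hφ : IsMate G φ) (hψ : IsMate G ψ) (hoff : ∀ x, x ∉ P → φ x ∉ P → ψ x = φ x)
    (hP : ∀ x ∈ P, ψ x ∉ P) : Side G ψ P q c := by
  have hcc : ∀ y ∈ c, ψ y = φ y := fun y hy => hoff y (hc.outside y hy).1 (hc.outside y hy).2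
  have hch := isChain_congr (ψ := ψ) hc.chain (by simpa using hcc)
  have hclose : ∀ x, x ∈ P ∨ x ∈ c → (q :: (c ++ [φ x])).IsChain (Arc G φ) →
      (q :: (c ++ [ψ x])).IsChain (Arc G ψ) := by
    intro x hx h
    rw [← List.cons_append, List.isChain_append] at h ⊢
    refine ⟨hch, by simp, ?_⟩
    intro y hy z hz
    obtain rfl : ψ x = z := by simpa using hz
    obtain ⟨h1, h2⟩ := h.2.2 y hy (φ x) (by simp)
    rw [hφ.invol] at h1
    refine ⟨by rwa [hψ.invol], ?_⟩
    rcases hx with hx | hx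
    · rintro rfl
      rcases List.mem_cons.1 (List.mem_of_getLast? hy) with h3 | h3
      · exact hP x hx (h3 ▸ hc.mem)
      · have := hcc _ h3
        rw [hψ.invol] at this
        exact (hc.outside _ h3).2 (this ▸ hx)
    · rwa [hcc x hx]
  refine ⟨hc.mem, hch, ?_, fun y hy => ?_, ?_⟩
  · rw [map_edge_congr hcc]; exact hc.nodup
  · rw [hcc y hy]; exact hc.outside y hy
  · rcases hc.close with ⟨r, u, hr, hu, hrm⟩ | ⟨hm, h⟩
    · refine .inl ⟨r, u, hr, ?_, fun y hy => ?_⟩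
      · rw [hcc u (by simp [hr])]; exact hu
      · rw [hcc y (by simp [hr, hy])]; exact hrm y hy
    · refine .inr ⟨fun y hy => by rw [hcc y hy]; exact hm y hy, ?_⟩
      rcases h with ⟨r, l, x, hr, hx, hch⟩ | ⟨q', hq', hne, hch⟩
      · refine .inl ⟨r, l, x, hr, hx, hclose x ?_ hch⟩
        rcases List.mem_cons.1 (List.mem_of_getLast? hx) with rfl | h
        · exact .inl hc.mem
        · exact .inr (by simp [hr, h])
      · exact .inr ⟨q', hq', hne, hclose q' (.inl hq') hch⟩

/-- A side of `{v}` cannot end at an unmatched vertex, by maximality of the matching, nor return at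
another member of `{v}`. So it closes a blossom, whose stem begins at `v`. -/
lemma IsMaxMate.inFlower_of_unmatched [Finite V] {φ : Equiv.Perm V} (hφ : IsMaxMate G φ) {v : V}
    (hv : φ v = v) (h : TransGen (Arc G φ) v (φ v)) : InFlower hφ.1.matching v := by
  obtain ⟨q, c, hc⟩ := hφ.1.exists_side (P := {v}) rfl h
  obtain rfl : q = v := hc.mem
  rcases hc.close with ⟨r, u, rfl, hu, hrm⟩ | ⟨hm, ⟨r, l, x, rfl, hx, hch⟩ | ⟨q', hq', hne, hch⟩⟩
  · have hn := hc.nodup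
    rw [List.map_append] at hn
    exact (hφ.not_augmenting hv hu (fun h => (hc.outside u (by simp)).1 h.symm) hc.chain hrm
      hn.of_append_left).elim
  · have hn := hc.nodup
    rw [List.map_append, List.nodup_append] at hn
    have hq : ∀ y ∈ r ++ l, edge φ y ≠ edge φ q := fun y hy =>
      (hφ.1.edge_ne_of_outside hc.mem (hc.outside y hy)).symm
    refine hφ.1.inFlower (u := q) (T := r) (b := x) (l := l) hv (hc.chain.prefix ⟨l, by simp⟩)
      (fun y hy => hm y (by simp [hy])) ?_ hx ?_ (fun y hy => hm y (by simp [hy])) hn.2.1 ?_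
      (by simp)
    · rw [List.map_cons, List.nodup_cons]
      refine ⟨fun h => ?_, hn.1⟩
      obtain ⟨y, hy, hyq⟩ := List.mem_map.1 h
      exact hq y (by simp [hy]) hyq
    · obtain ⟨s, hs⟩ := eq_concat_of_getLast? hx
      refine hch.suffix ⟨s, ?_⟩
      have : q :: (r ++ l ++ [φ x]) = (q :: r) ++ (l ++ [φ x]) := by simp
      rw [this, hs]; simp
    · intro y hy h
      rw [List.map_cons, List.mem_cons] at h
      rcases h with h | h
      · exact hq y (by simp [hy]) h
      · exact hn.2.2 _ h _ (List.mem_map_of_mem hy) rfl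
  · exact absurd hq' hne

lemma IsMaxMate.exists_of_bireachable [Finite V] {φ : Equiv.Perm V} (hφ : IsMaxMate G φ) {v : V}
    (h : IsMate.Bireachable G φ v) :
    ∃ (ψ : Equiv.Perm V) (hψ : IsMaxMate G ψ),
      InFlower hψ.1.matching v ∨ InTposy hψ.1.matching v := by
  by_cases hv : φ v = v
  · exact ⟨φ, hφ, .inl (hφ.inFlower_of_unmatched hv h.1)⟩
  obtain ⟨P, hvP, hP, hmax⟩ := exists_maximal_elementary (G := G) hv
  obtain ⟨q, c, hc⟩ := hφ.1.exists_side hvP h.1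
  obtain ⟨t, d, hd⟩ := hφ.1.exists_side (P := {x | φ x ∈ P}) (v := φ v)
    (by simpa [hφ.1.invol] using hvP) (by simpa [hφ.1.invol] using h.2)
  have htP : φ t ∈ P := hd.mem
  have hwalk : ∀ x ∈ P, ∀ y ∈ P, ∃ l, (x :: l).IsChain (Arc G φ) ∧ (∀ z ∈ x :: l, z ∈ P) ∧
      (x :: l).getLast? = some y := by
    intro x hx y hy
    obtain ⟨w, hw, l, h1, -, h2, h3⟩ := exists_exit_path (S := [x]) (by simp) (hP.conn x hx y hy)
    obtain rfl : w = x := by simpa using hw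
    refine ⟨l, h1, fun z hz => ?_, h3⟩
    rcases List.mem_cons.1 hz with rfl | hz
    exacts [hx, (h2 z hz).1]
  obtain ⟨A, hA1, hA2, hA3⟩ := hwalk _ htP v hvP
  obtain ⟨B, hB1, hB2, hB3⟩ := hwalk v hvP q hc.mem
  obtain ⟨A', hA'⟩ := eq_concat_of_getLast? hA3
  obtain ⟨ψ, hψ, hψP, hoff, hiff, L, hL1, hL2, hL3, ⟨p, hp, hpt⟩, hL5, hvL⟩ :=
    exists_path_through (t := t) (q := q) (v := v) (A'.length + B.length) hφ hP (A := A') (B := B)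
      le_rfl (List.isChain_split.2 ⟨hA' ▸ hA1, hB1⟩) (by
        intro x hx
        rcases List.mem_append.1 hx with hx | hx
        · exact hA2 x (by rw [hA']; simp [hx])
        · exact hB2 x hx) (by
        refine ⟨φ t, ?_, hφ.1.invol t⟩
        have : (A' ++ v :: B) = (φ t :: A) ++ B := by rw [hA']; simp
        rw [this]; rfl) hB3
  refine ⟨ψ, hψ, ?_⟩
  have hLm : ∀ y ∈ L, ψ y ≠ y := fun y hy h => hψP.disj y (hL3 y hy) (by rw [h]; exact hL3 y hy)
  have hLe : (L.map (edge ψ)).Nodup := hψ.1.nodup_map_edge hψP.disj hL2 hL3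
  -- The alternative is settled for `φ`, for which `P` is known to be maximal; only its outcome is
  -- transferred to `ψ`.
  rcases hφ.1.disjoint_or_merge hP hmax hc hd with hdis |
    ⟨c₁, d₁, z, hc₁, hd₁, hn, hm, hz, hzn, hend⟩
  · have hc' : Side G ψ P q c := hc.congr hφ.1 hψ.1 hoff hψP.disj
    have hN : {x | φ x ∈ P} = {x | ψ x ∈ P} := by ext x; exact (hiff x).symm
    have hd' : Side G ψ {x | ψ x ∈ P} t d := by
      rw [← hN]
      refine hd.congr hφ.1 hψ.1 (fun x hx hx' => hoff x ?_ hx) ?_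
      · simpa [hφ.1.invol] using hx'
      · intro x hx hx'
        rw [hN] at hx hx'
        exact hψP.disj _ hx hx'
    have hNE := IsMate.Elementary.mirror hψ.1 hψP
    have hdo : ∀ y ∈ d, y ∉ P ∧ ψ y ∉ P := by
      intro y hy
      have := hd'.outside y hy
      simp only [Set.mem_ofPred_eq, hψ.1.invol] at this
      exact this.symm
    have hdis' : ∀ y ∈ c, ∀ w ∈ d, edge ψ y ≠ edge ψ w := by
      intro y hy w hw h
      apply hdis y hy
      have h1 := hc.outside y hy
      have h2 := hd.outside w hw
      simp only [Set.mem_ofPred_eq, hφ.1.invol] at h2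
      rw [edge, edge, hoff y h1.1 h1.2, hoff w h2.2 h2.1] at h
      exact List.mem_map.2 ⟨w, hw, h.symm⟩
    have hout : ∀ y, (y ∈ P ∨ ψ y ∈ P) → ∀ w, (w ∉ P ∧ ψ w ∉ P) → edge ψ y ≠ edge ψ w := by
      intro y hy w hw
      rcases hy with hy | hy
      · exact hψ.1.edge_ne_of_outside hy hw
      · rw [← hψ.1.edge_apply y]; exact hψ.1.edge_ne_of_outside hy hw
    -- The end of `L` at `q` is completed first, using `c`; what is left of `L` is then reversed and
    -- completed using `d`.
    obtain ⟨L₁, L₂, r, b, l, hL, hL₁, hr1, hr2, hr3, hr4, hT, hl1, hl2, hcov⟩ :=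
      hψ.1.exists_terminal hψP hL1 hL2 hL3 hL5 hc'
    obtain ⟨p₁, L₁', rfl⟩ := List.exists_cons_of_ne_nil hL₁
    have hpp : p₁ = p := by rw [hL] at hp; simpa using hp
    have hL₁sub : ∀ y ∈ p₁ :: L₁', y ∈ L := fun y hy => by rw [hL]; exact List.mem_append_left _ hy
    obtain ⟨K₁, K₂, r', b', l', hK, hK₁, hr1', hr2', hr3', hr4', hT', hl1', hl2', hcov'⟩ :=
      hψ.1.exists_terminal hNE (L := mirror ψ (p₁ :: L₁')) (c := d) (q := t)
        (hψ.1.isChain_mirror hr1.left_of_append)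
        (by
          rw [mirror, List.nodup_reverse]
          refine List.Nodup.map ψ.injective ?_
          rw [hL] at hL2; exact hL2.of_append_left)
        (by
          intro x hx
          rw [hψ.1.mem_mirror] at hx
          exact hL3 _ (hL₁sub _ hx))
        (by simp [hpp, hpt]) hd'
    have hK' : p₁ :: L₁' = mirror ψ K₂ ++ mirror ψ K₁ := by
      rw [← mirror_append, ← hK, hψ.1.mirror_mirror]
    have hKL : ∀ y ∈ mirror ψ K₁, y ∈ L := fun y hy =>
      hL₁sub y (by rw [hK']; exact List.mem_append_right _ hy)
    have hKe : ∀ e ∈ (mirror ψ K₁).map (edge ψ), e ∈ (p₁ :: L₁').map (edge ψ) := by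
      intro e he
      rw [hK', List.map_append, List.mem_append]; exact .inr he
    have hK0 : mirror ψ K₁ ≠ [] := by simpa using hK₁
    set T := mirror ψ r' ++ mirror ψ K₁ ++ r with hTdef
    have hTc : T.IsChain (Arc G ψ) := by
      refine List.IsChain.append_overlap ?_ ?_ hK0
      · have := hψ.1.isChain_mirror hr1'
        rwa [mirror_append] at this
      · rw [hK'] at hr1
        rw [List.append_assoc] at hr1
        exact hr1.right_of_append
    have hmemT : ∀ {e}, e ∈ T.map (edge ψ) ↔
        (e ∈ r'.map (edge ψ) ∨ e ∈ K₁.map (edge ψ)) ∨ e ∈ r.map (edge ψ) := by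
      intro e
      rw [hTdef, List.map_append, List.map_append, List.mem_append, List.mem_append,
        hψ.1.edge_mem_mirror, hψ.1.edge_mem_mirror]
    have hK1P : ∀ y ∈ K₁, y ∈ P ∨ ψ y ∈ P := by
      intro y hy
      exact .inr (hL3 _ (hKL _ (by rw [hψ.1.mem_mirror, hψ.1.invol]; exact hy)))
    refine hψ.inFlower_or_inTposy (T := T) (a := ψ b') (b := b) (l₁ := l') (l₂ := l) hTc ?_ ?_ ?_ ?_
      ?_ ?_ ?_
    · intro y hy
      rw [hTdef, List.mem_append, List.mem_append, hψ.1.mem_mirror] at hy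
      rcases hy with (hy | hy) | hy
      · exact fun h => (hr3' _ hy).2 (by rw [h, h])
      · exact hLm y (hKL y hy)
      · exact (hr3 y hy).2
    · rw [hTdef, List.map_append, List.map_append, List.nodup_append, List.nodup_append,
        hψ.1.nodup_edge_mirror]
      refine ⟨⟨hr4', ?_, ?_⟩, hr4, ?_⟩
      · rw [hL, hK', List.map_append, List.map_append] at hLe
        exact hLe.of_append_left.of_append_right
      · rintro e he _ he' rfl
        rw [hψ.1.edge_mem_mirror] at he he'
        obtain ⟨y, hy, rfl⟩ := List.mem_map.1 he
        obtain ⟨w, hw, hwy⟩ := List.mem_map.1 he'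
        exact hout w (hK1P w hw) y (hdo y (hr3' y hy).1) hwy
      · rintro e he _ he' rfl
        obtain ⟨y, hy, rfl⟩ := List.mem_map.1 he'
        rw [List.mem_append, hψ.1.edge_mem_mirror, hψ.1.edge_mem_mirror] at he
        rcases he with he | he
        · obtain ⟨w, hw, hwy⟩ := List.mem_map.1 he
          exact hdis' y (hr3 y hy).1 w (hr3' w hw).1 hwy.symm
        · obtain ⟨w, hw, hwy⟩ := List.mem_map.1 he
          exact hout w (hK1P w hw) y (hc'.outside y (hr3 y hy).1) hwy
    · have : mirror ψ r' ++ mirror ψ K₁ = mirror ψ (K₁ ++ r') := by simp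
      rw [hTdef, List.head?_append, this, mirror, List.head?_reverse, List.getLast?_map, hr2']
      rfl
    · rw [hK', List.append_assoc] at hr2
      rw [hTdef, List.append_assoc]
      rw [List.getLast?_append] at hr2 ⊢
      obtain ⟨w, hw⟩ : ∃ w, (mirror ψ K₁ ++ r).getLast? = some w :=
        ⟨_, List.getLast?_eq_some_getLast (by simp [hK₁])⟩
      rw [hw] at hr2 ⊢
      exact hr2
    · rw [hψ.1.invol]
      refine hT'.mono fun y hy h => ?_
      have h1 := hl2' y hy
      rw [List.map_append, List.mem_append, not_or] at h1
      rcases hmemT.1 h with (h | h) | h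
      · exact h1.2 h
      · exact h1.1 h
      · obtain ⟨w, hw, hwy⟩ := List.mem_map.1 h
        rcases hl1' y hy with h2 | h2
        · refine hout y ?_ w (hc'.outside w (hr3 w hw).1) hwy.symm
          simp only [Set.mem_ofPred_eq, hψ.1.invol] at h2
          exact h2.symm
        · exact hdis' w (hr3 w hw).1 y h2 hwy
    · refine hT.mono fun y hy h => ?_
      have h1 := hl2 y hy
      rw [List.map_append, List.mem_append, not_or] at h1
      rcases hmemT.1 h with (h | h) | h
      · obtain ⟨w, hw, hwy⟩ := List.mem_map.1 h
        rcases hl1 y hy with h2 | h2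
        · exact hout y h2 w (hdo w (hr3' w hw).1) hwy.symm
        · exact hdis' y h2 w (hr3' w hw).1 hwy.symm
      · exact h1.1 (hKe _ (hψ.1.edge_mem_mirror.2 h))
      · exact h1.2 h
    -- `v` is still on the path, or was cut off at one end and is covered by the blossom there.
    · rw [List.map_append, List.map_append, List.mem_append, List.mem_append, hmemT]
      rw [hL, List.mem_append] at hvL
      rcases hvL with hvL | hvL
      · rw [hK', List.mem_append] at hvL
        rcases hvL with hvL | hvL
        · rw [hψ.1.mem_mirror] at hvL
          have := hcov' _ hvL
          rw [hψ.1.edge_apply] at this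
          exact .inl this
        · exact .inr (.inl (.inl (.inr (hψ.1.edge_mem_mirror.1 (List.mem_map_of_mem hvL)))))
      · exact .inr (.inr (hcov v hvL))
  · have hψo : ∀ y, y ∉ P ∧ φ y ∉ P → ψ y = φ y := fun y hy => hoff y hy.1 hy.2
    have hψz : ψ z = φ z := hψo z hz
    have hcd : ∀ y ∈ d₁ ++ c₁, ψ y = φ y := fun y hy => hψo y (hm y hy).2
    have hc₁' : (q :: (c₁ ++ [z])).IsChain (Arc G ψ) := by
      refine isChain_congr hc₁ fun y hy => ?_
      rw [List.tail_cons, List.mem_append, List.mem_singleton] at hy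
      rcases hy with hy | rfl
      exacts [hcd y (List.mem_append_right _ hy), hψz]
    have hd₁' : (t :: (d₁ ++ [z])).IsChain (Arc G ψ) := by
      refine isChain_congr hd₁ fun y hy => ?_
      rw [List.tail_cons, List.mem_append, List.mem_singleton] at hy
      rcases hy with hy | rfl
      exacts [hcd y (List.mem_append_left _ hy), hψz]
    -- From `ψ z` backwards along `d₁` to `ψ t`, through `L`, and along `c₁` to `z`: a blossom
    -- through `v` with base `ψ z`.
    set l := mirror ψ d₁ ++ (L ++ c₁) with hl
    have hlc : (ψ z :: (l ++ [z])).IsChain (Arc G ψ) := by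
      have h1 := hψ.1.isChain_mirror hd₁'
      have htp : ψ t = p := by rw [← hpt, hψ.1.invol]
      obtain ⟨L', hL'⟩ : ∃ L', L = p :: L' := by
        cases L with
        | nil => simp at hp
        | cons a L' => exact ⟨L', by simpa using hp⟩
      obtain ⟨L₀, hL₀⟩ := eq_concat_of_getLast? hL5
      have h2 : (L ++ (c₁ ++ [z])).IsChain (Arc G ψ) := by
        rw [hL₀] at hL1 ⊢
        rw [List.append_assoc, List.singleton_append]
        exact List.isChain_split.2 ⟨hL1, hc₁'⟩
      have h3 : ((ψ z :: mirror ψ d₁) ++ p :: (L' ++ (c₁ ++ [z]))).IsChain (Arc G ψ) := by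
        refine List.isChain_split.2 ⟨?_, by rw [hL'] at h2; exact h2⟩
        simpa [htp] using h1
      rw [hl, hL']
      simpa using h3
    have hmeml : ∀ {e}, e ∈ l.map (edge ψ) ↔
        e ∈ L.map (edge ψ) ∨ e ∈ (d₁ ++ c₁).map (edge ψ) := by
      intro e
      simp only [hl, List.map_append, List.mem_append, hψ.1.edge_mem_mirror]
      tauto
    have hll : ∀ y, y ∉ P ∧ φ y ∉ P → edge φ y ∉ (d₁ ++ c₁).map (edge φ) →
        edge ψ y ∉ l.map (edge ψ) := by
      intro y hy h1 h2
      have hyψ := hψo y hy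
      rcases hmeml.1 h2 with h2 | h2
      · obtain ⟨w, hw, hwy⟩ := List.mem_map.1 h2
        exact hψ.1.edge_ne_of_outside (hL3 w hw) (by rwa [hyψ]) hwy
      · rw [map_edge_congr hcd, edge, hyψ] at h2
        exact h1 h2
    have hlm : ∀ y ∈ l, ψ y ≠ y := by
      intro y hy
      rw [hl, List.mem_append, List.mem_append, hψ.1.mem_mirror] at hy
      rcases hy with hy | hy | hy
      · intro h
        have h1 := List.mem_append_left c₁ hy
        exact (hm _ h1).1 (by rw [← hcd _ h1, h, h])
      · exact hLm y hy
      · have h1 := List.mem_append_right d₁ hy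
        rw [hcd y h1]; exact (hm y h1).1
    have hln : (l.map (edge ψ)).Nodup := by
      rw [← map_edge_congr hcd, List.map_append, List.nodup_append] at hn
      rw [hl, List.map_append, List.map_append, List.nodup_append, List.nodup_append,
        hψ.1.nodup_edge_mirror]
      have hLo : ∀ e ∈ L.map (edge ψ), e ∉ (d₁ ++ c₁).map (edge ψ) := by
        intro e he he'
        obtain ⟨w, hw, rfl⟩ := List.mem_map.1 he
        obtain ⟨y, hy, hyw⟩ := List.mem_map.1 he'
        have h1 := (hm y hy).2
        refine hψ.1.edge_ne_of_outside (hL3 w hw) ?_ hyw.symm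
        rwa [hψo y h1]
      refine ⟨hn.1, ⟨hLe, hn.2.1, ?_⟩, ?_⟩
      · rintro e he _ he' rfl
        exact hLo e he (by rw [List.map_append, List.mem_append]; exact .inr he')
      · rintro e he _ he' rfl
        rw [hψ.1.edge_mem_mirror] at he
        rcases List.mem_append.1 he' with he' | he'
        · exact hLo e he' (by rw [List.map_append, List.mem_append]; exact .inl he)
        · exact hn.2.2 e he e he' rfl
    have hvl : edge ψ v ∈ l.map (edge ψ) := hmeml.2 (.inl (List.mem_map_of_mem hvL))
    rcases hend with hzz | ⟨s, b, m, hs1, hs2, hs3, hs4, hs5, hs6, hs7⟩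
    · left
      rw [← hψz] at hzz
      refine hψ.1.inFlower (u := z) (b := z) (T := []) (l := l) hzz (by simp) (by simp) (by simp)
        (by simp) ?_ hlm hln ?_ ?_
      · rw [hzz] at hlc ⊢; exact hlc
      · intro y hy h
        simp only [List.map_cons, List.map_nil, List.mem_singleton] at h
        exact hll z hz hzn (h ▸ List.mem_map_of_mem hy)
      · rw [List.nil_append, List.map_cons, List.mem_cons]; exact .inr hvl
    · have hse : ∀ y ∈ z :: s, ψ y = φ y := fun y hy => hψo y (hs7 y (List.mem_append_left _ hy))
      have hme : ∀ y ∈ m, ψ y = φ y := fun y hy => hψo y (hs7 y (List.mem_append_right _ hy))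
      -- The common continuation of both sides joins this blossom to the terminal of `d`.
      refine hψ.inFlower_or_inTposy (T := z :: s) (a := z) (b := b) (l₁ := l) (l₂ := m)
        (isChain_congr hs1 fun y hy => hse y (List.mem_of_mem_tail hy))
        (fun y hy => by rw [hse y hy]; exact hs2 y hy) (by rw [map_edge_congr hse]; exact hs3) rfl
        hs4 (.inr ⟨by rw [hψ.1.invol]; exact hlc, hlm, hln, ?_⟩) ?_ ?_
      · intro y hy h
        obtain ⟨w, hw, hwy⟩ := List.mem_map.1 h
        exact hll w (hs7 w (List.mem_append_left _ hw)) (hs6 w hw)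
          (hwy ▸ List.mem_map_of_mem hy)
      · have hb : ψ b = φ b := hse b (List.mem_of_getLast? hs4)
        rcases hs5 with ⟨u, rfl, hu, hbu⟩ | ⟨h1, h2, h3, h4⟩
        · have huu := hme u (by simp)
          exact .inl ⟨u, rfl, huu.trans hu, by rw [huu]; exact hbu.1, hbu.2⟩
        · refine .inr ⟨?_, fun y hy => by rw [hme y hy]; exact h2 y hy,
            by rw [map_edge_congr hme]; exact h3, fun y hy => ?_⟩
          · rw [hb]
            refine isChain_congr h1 fun y hy => ?_
            rw [List.tail_cons, List.mem_append, List.mem_singleton] at hy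
            rcases hy with hy | rfl
            · exact hme y hy
            · rw [← hb, hψ.1.invol, hb, hφ.1.invol]
          · rw [map_edge_congr hse, edge, hme y hy]
            exact h4 y hy
      · rw [List.map_append, List.mem_append]; exact .inl hvl

lemma VJ_subset_VT [Finite V] : VJ G ⊆ VT G := by
  rintro v ⟨M, hM, h⟩
  obtain ⟨φ, hφ, rfl⟩ := hM.exists_isMaxMate
  have hv : IsMate.Bireachable G φ v :=
    h.elim hφ.1.bireachable_of_inJflower hφ.1.bireachable_of_inJposy
  obtain ⟨ψ, hψ, h⟩ := hφ.exists_of_bireachable hv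
  exact ⟨_, hψ.isMaximumMatching, h⟩

end SterboulDeming

theorem mainTheorem1 {V : Type*} [Finite V] (G : SimpleGraph V) :
    SterboulDeming.VT G = SterboulDeming.VESG G ∧
      SterboulDeming.VESG G = SterboulDeming.VJ G :=
  ⟨SterboulDeming.VT_subset_VESG.antisymm
      (SterboulDeming.VESG_subset_VJ.trans SterboulDeming.VJ_subset_VT),
    SterboulDeming.VESG_subset_VJ.antisymm
      (SterboulDeming.VJ_subset_VT.trans SterboulDeming.VT_subset_VESG)⟩
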